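/- Let $p\ge 1$, $n\ge p$, $d\ge 0$ be integers and $[a,b]$ an interval, $a<b$, $\gamma:=b-a$. Let $\Gamma$ be an open or a closed curve parametrized on $[a,b]$, and put $\delta(s,t):=|s-t|$ if $\Gamma$ is open and $\delta(s,t):=|s-t|\,|(s-t)^2-\gamma^2|\,\gamma^{-2}$ if $\Gamma$ is closed. **Hierarchical B-splines.** Consider uniform partitions of $[a,b]$, where level $\ell$ arises from level $0$ by $\ell$ dyadic refinements and has mesh size $h_\ell$. Consider nested sets $[a,b]=\hat\Gamma^0\supseteq\hat\Gamma^1\supseteq\dots\supseteq\hat\Gamma^M=\emptyset$ with $\hat\Gamma^{\ell+1}$ a union of closed cells of level $\ell$. Level $\ell$ carries the B-splines of degree $d$ on simple uniform knots; the end knots $a,b$ are repeated (open knot vector) for an open curve, and the knots are continued uniformly, hence periodically, for a closed curve. The hierarchical basis $\mathcal H$ consists of the B-splines of some level $\ell<M$ whose support lies in $\hat\Gamma^\ell$ but not in $\hat\Gamma^{\ell+1}$. For a closed curve the sets $\hat\Gamma^\ell$ and the integrand $g$ are continued with period $\gamma$, and a B-spline that crosses the seam is regarded as one function on an interval that leaves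 $[a,b]$. Write $\ell_i$ for the level of $B_i^{\mathcal H}$ and $D_i$ for its (closed, interval) support. **Quasi-interpolant.** On $D_i$ take the $n+1$ uniform nodes $\tau_0<\dots<\tau_n$ that include the end points, with spacing $\eta$, and the B-splines $B_{j,p}$, $-p\le j\le n-1$, of degree $p$ on the associated open knot vector. The Hermite quasi-interpolant is $\sum_j\lambda_j(g)B_{j,p}$ with $$\lambda_j(g)=\sum_{r=0}^{p-1}\alpha^{(j)}_r\, g(\tau_{\nu+r})-\eta\sum_{r=0}^{p-1}\beta^{(j)}_r\, g'(\tau_{\nu+r}),\qquad \nu=\max(0,\min(j+1,n-p+1)),$$ where $(\alpha^{(j)},\beta^{(j)})$ solves the $2p\times2p$ linear system $\lambda_j(B_{m,p})=\delta_{jm}$ for $\nu-p\le m\le\nu+p-2$, $\sum_r\beta^{(j)}_r=0$. (For $p=2$ and $0\le j+1\le n-1$ this is $\frac12(g(\tau_{j+1})+g(\tau_{j+2}))-\frac{\eta}{4}(g'(\tau_{j+2})-g'(\tau_{j+1}))$, and $\lambda_{-2}(g)=g(\tau_0)$, $\lambda_{n-1}(g)=g(\tau_n)$.) The spline $\sigma_g$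 is obtained by replacing each $g'(\tau_r)$ by a finite difference, the derivative at $\tau_r$ of the polynomial interpolating $g$ at a fixed stencil of at least $p+1$ of the nodes; the stencils are part of the scheme and do not depend on $i$. Thus $\sigma_g$ depends only on $g(\tau_0),\dots,g(\tau_n)$. **Rules and errors.** The two quadrature rules are $\mathcal I^Q_{B_i^{\mathcal H}}[g]=\int_{D_i}B_i^{\mathcal H}\sigma_g$ and $\mathcal I^Q_{w_i^s}[g]=\int_{D_i}\log\delta(s,t)\,B_i^{\mathcal H}(t)\,\sigma_g(t)\,dt$, written as linear combinations of the $n+1$ values $g(\tau_k)$. Their errors are $$e(h_{\ell_i})=\int_{D_i}B_i^{\mathcal H}g-\mathcal I^Q_{B_i^{\mathcal H}}[g],\qquad E(h_{\ell_i},s)=\int_{D_i}\log\delta(s,t)\,B_i^{\mathcal H}(t)\,g(t)\,dt-\mathcal I^Q_{w_i^s}[g].$$ **Proposition.** There are positive constants $C_1,C_2,h_0$, depending only on $p,n,d,a,b$, the stencils and the type of the curve (not on $g$, $s$, the hierarchy or $i$), such that for every $g\in C^{p+1}[a,b]$, every such hierarchy, every $B_i^{\mathcal H}\in\mathcal H$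 with $h_{\ell_i}\le h_0$ (if $D_i\not\subseteq[a,b]$, the periodic continuation of $g$ is assumed to be $C^{p+1}$ on $D_i$) and every $s\in[a,b]$, $$|e(h_{\ell_i})|\le C_1h_{\ell_i}^{p+2}\,\|D^{p+1}g\|_{L^\infty(D_i)},\qquad |E(h_{\ell_i},s)|\le C_2h_{\ell_i}^{p+2}\,|\log h_{\ell_i}|\,\|D^{p+1}g\|_{L^\infty(D_i)}.$$ -/

import Mathlib

namespace QIQuad

/-! ### B-splines and uniform knot sequences -/

/-- The factor `ω_{i,r}(t)` of the B-spline recursion on the knots `T` (with `0` when the two knots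
coincide). -/
noncomputable def omega (T : ℤ → ℝ) (r : ℕ) (i : ℤ) (t : ℝ) : ℝ :=
  if T i < T (i + r) then (t - T i) / (T (i + r) - T i) else 0

/-- The B-spline `B_{i,r}` of degree `r` on the non-decreasing knot sequence `T : ℤ → ℝ`, by the
Cox - de Boor recursion. In degree `0` it is the indicator of `[T i, T (i+1))`; only if `T (i+1)` is
the largest knot of all, the right end point belongs to the interval too (the usual convention by
which the B-splines on a clamped knot vector form a partition of unity on the closed interval). -/
noncomputable def bspline (T : ℤ → ℝ) : ℕ → ℤ → ℝ → ℝ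
  | 0, i, t =>
      open Classical in
      if T i < T (i + 1) ∧ T i ≤ t ∧ (t < T (i + 1) ∨ (t = T (i + 1) ∧ ∀ k, T k ≤ T (i + 1)))
      then 1 else 0
  | r + 1, i, t =>
      omega T (r + 1) i t * bspline T r i t
        + (1 - omega T (r + 1) (i + 1) t) * bspline T r (i + 1) t

/-- The knots of the uniform partition of `[x, x + N h]` into `N` cells of length `h`, with the first
and the last breakpoint repeated indefinitely (only finitely many repetitions enter any B-spline that
does not vanish identically): the open (clamped) knot vector. -/
noncomputable def clampedKnots (x h : ℝ) (N : ℕ) (m : ℤ) : ℝ :=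
  x + h * ((max 0 (min m (N : ℤ)) : ℤ) : ℝ)

/-- The knots of a uniform partition with mesh size `h`, continued uniformly in both directions. -/
noncomputable def uniformKnots (x h : ℝ) (m : ℤ) : ℝ := x + h * (m : ℝ)

/-! ### Hierarchical B-splines -/

/-- The two types of boundary curves. -/
inductive CurveKind where
  | openArc
  | closedCurve

/-- A dyadic hierarchy of subdomains `Γ^0 ⊇ Γ^1 ⊇ … ⊇ Γ^M = ∅` of `[a, b] = Γ^0`. The partition of
level `ℓ` is the uniform one with `L * 2 ^ ℓ` cells, and `Γ^(ℓ+1)` is a union of (closed) cells of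
level `ℓ`. -/
structure Hierarchy (a b : ℝ) where
  L : ℕ
  L_pos : 0 < L
  M : ℕ
  region : ℕ → Set ℝ
  region_zero : region 0 = Set.Icc a b
  region_last : region M = ∅
  region_subset : ∀ ℓ, region (ℓ + 1) ⊆ region ℓ
  region_cells : ∀ ℓ, ∃ K : Set ℕ, K ⊆ {k | k < L * 2 ^ ℓ} ∧
    region (ℓ + 1) = ⋃ k ∈ K,
      Set.Icc (a + (b - a) / (L * 2 ^ ℓ) * k) (a + (b - a) / (L * 2 ^ ℓ) * (k + 1))

namespace Hierarchy

variable {a b : ℝ}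

/-- Number of cells of level `ℓ`. -/
def numCells (H : Hierarchy a b) (ℓ : ℕ) : ℕ := H.L * 2 ^ ℓ

/-- The mesh size `h_ℓ` of level `ℓ`. -/
noncomputable def meshSize (H : Hierarchy a b) (ℓ : ℕ) : ℝ := (b - a) / (H.numCells ℓ : ℝ)

/-- The knot vector `T^ℓ` of level `ℓ`: clamped for open curves, uniformly (hence periodically)
continued for closed curves. The breakpoint `a` has index `0`, the breakpoint `b` has index
`numCells ℓ`. -/
noncomputable def knots (H : Hierarchy a b) (c : CurveKind) (ℓ : ℕ) : ℤ → ℝ :=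
  match c with
  | .openArc => clampedKnots a (H.meshSize ℓ) (H.numCells ℓ)
  | .closedCurve => uniformKnots a (H.meshSize ℓ)

/-- The subdomain `Γ^ℓ`; for closed curves it is extended periodically outside `[a, b]`. -/
def extRegion (H : Hierarchy a b) (c : CurveKind) (ℓ : ℕ) : Set ℝ :=
  match c with
  | .openArc => H.region ℓ
  | .closedCurve => {x | ∃ k : ℤ, x + k * (b - a) ∈ H.region ℓ}

/-- The B-spline of degree `d`, level `ℓ` and index `m`. -/
noncomputable def B (H : Hierarchy a b) (c : CurveKind) (d ℓ : ℕ) (m : ℤ) : ℝ → ℝ :=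
  bspline (H.knots c ℓ) d m

/-- Left end point of the support of `B c d ℓ m`. -/
noncomputable def left (H : Hierarchy a b) (c : CurveKind) (ℓ : ℕ) (m : ℤ) : ℝ :=
  H.knots c ℓ m

/-- Right end point of the support of `B c d ℓ m`. -/
noncomputable def right (H : Hierarchy a b) (c : CurveKind) (d ℓ : ℕ) (m : ℤ) : ℝ :=
  H.knots c ℓ (m + d + 1)

/-- The support `D_i` of `B c d ℓ m`: the interval spanned by its active knots. For a closed curve a
B-spline that crosses the seam is kept in one piece, so that `D_i` may leave `[a, b]`. -/
def supp (H : Hierarchy a b) (c : CurveKind) (d ℓ : ℕ) (m : ℤ) : Set ℝ :=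
  Set.Icc (H.left c ℓ m) (H.right c d ℓ m)

/-- `B c d ℓ m` belongs to the hierarchical basis: it is one of the B-splines of level `ℓ < M`, its
support lies in `Γ^ℓ` and does not lie in `Γ^(ℓ+1)`. (For closed curves the indices `m` and
`m + numCells ℓ` with `-d ≤ m < 0` stand for the same periodic function, seen from the two ends of
`[a, b]`.) -/
def IsActive (H : Hierarchy a b) (c : CurveKind) (d ℓ : ℕ) (m : ℤ) : Prop :=
  ℓ < H.M ∧ -(d : ℤ) ≤ m ∧ m < (H.numCells ℓ : ℤ) ∧
    H.supp c d ℓ m ⊆ H.extRegion c ℓ ∧ ¬ H.supp c d ℓ m ⊆ H.extRegion c (ℓ + 1)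

end Hierarchy

/-! ### The Hermite quasi-interpolant with finite difference derivatives

Everything here lives on the reference nodes `0, 1, …, n`; the scheme on a uniform partition of any
interval arises by an affine change of variables. -/

/-- Matrix of the local `2p × 2p` linear system on the `p` consecutive nodes `i, …, i + p - 1`. The
unknowns are the `p` weights `α` of the values and the `p` weights `β` of the derivatives of a
functional `s ↦ ∑ α_r s(i + r) - ∑ β_r s'(i + r)`. The first `2p - 1` rows hold the values of this
functional on the B-splines that do not vanish identically between the nodes (those with index
`i - p, …, i + p - 2`), the last row is the normalization `∑ β_r`. -/
noncomputable def bsMatrix (p n i : ℕ) : Matrix (Fin (2 * p)) (Fin (2 * p)) ℝ :=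
  Matrix.of fun row col =>
    let f : ℝ → ℝ := bspline (clampedKnots 0 1 n) p ((i : ℤ) - p + (row : ℕ))
    if (row : ℕ) + 1 < 2 * p then
      if (col : ℕ) < p then f ((i + (col : ℕ) : ℕ) : ℝ)
      else - derivWithin f (Set.Icc 0 (n : ℝ)) ((i + ((col : ℕ) - p) : ℕ) : ℝ)
    else
      if (col : ℕ) < p then 0 else 1

/-- First node of the window used by the coefficient functional of the B-spline with index `j`: the
nodes are `j + 1, …, j + p` (the interior knots of the B-spline), or the first (last) `p` nodes near
the left (right) end. -/
def windowStart (p n : ℕ) (j : ℤ) : ℕ := (max 0 (min (j + 1) ((n : ℤ) - p + 1))).toNat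

/-- The solution `(α, β)` of the local system for the B-spline with index `j`: the functional takes
the value `1` on this B-spline and `0` on the others, and `∑ β_r = 0`. -/
noncomputable def bsCoeff (p n : ℕ) (j : ℤ) : Fin (2 * p) → ℝ :=
  Matrix.mulVec (bsMatrix p n (windowStart p n j))⁻¹
    (fun row => if ((row : ℕ) : ℤ) = j - ((windowStart p n j : ℤ) - p) then 1 else 0)

/-- Finite difference weights: `∑ k, fdWeight S r k * y k` is the derivative at the node `r` of the
polynomial that interpolates the data `y` at the nodes of the stencil `S r`. -/
noncomputable def fdWeight (S : ℕ → Finset ℕ) (r k : ℕ) : ℝ :=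
  if k ∈ S r then
    (Polynomial.derivative (Lagrange.basis (S r) (fun q : ℕ => (q : ℝ)) k)).eval (r : ℝ)
  else 0

/-- A choice of finite difference stencils for degree `p` on the nodes `0, …, n`: at every node at
least `p + 1` of the nodes are used. -/
def IsStencil (p n : ℕ) (S : ℕ → Finset ℕ) : Prop :=
  ∀ r ≤ n, S r ⊆ Finset.range (n + 1) ∧ p + 1 ≤ (S r).card

/-- The matrix `Ĉ`: entry `(k, j)` is the weight of the value at node `k` in the `j`-th coefficient
functional, after the derivatives have been replaced by finite differences. -/
noncomputable def qiMatrix (p n : ℕ) (S : ℕ → Finset ℕ) (k : ℕ) (j : ℤ) : ℝ :=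
  ∑ col : Fin (2 * p),
    if (col : ℕ) < p then
      if k = windowStart p n j + (col : ℕ) then bsCoeff p n j col else 0
    else - bsCoeff p n j col * fdWeight S (windowStart p n j + ((col : ℕ) - p)) k

/-! ### The quadrature rules -/

/-- The quadrature nodes: `n + 1` uniform nodes on `[x, y]`. -/
noncomputable def node (x y : ℝ) (n k : ℕ) : ℝ := x + (y - x) / n * k

/-- The B-spline of degree `p` and index `j`, `-p ≤ j ≤ n - 1`, on the open knot vector of the
uniform partition of `[x, y]` into `n` cells. -/
noncomputable def qiBasis (x y : ℝ) (p n : ℕ) (j : ℤ) : ℝ → ℝ :=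
  bspline (clampedKnots x ((y - x) / n) n) p j

/-- The quasi-interpolation quadrature rule on `[x, y]` with the weight function `w` applied to `g`.
The weight of node `k` is `∑ j, Ĉ k j * ∫ w * B_j`, so that the rule integrates `w` times the
quasi-interpolating spline `∑ j, (∑ k, Ĉ k j * g (node k)) * B_j` exactly. -/
noncomputable def qiRule (x y : ℝ) (p n : ℕ) (S : ℕ → Finset ℕ) (w g : ℝ → ℝ) : ℝ :=
  ∑ k ∈ Finset.range (n + 1),
    (∑ j ∈ Finset.Ico (-(p : ℤ)) (n : ℤ),
      qiMatrix p n S k j * ∫ t in Set.Icc x y, w t * qiBasis x y p n j t) * g (node x y n k)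

/-- The distance function `δ`. -/
noncomputable def delta (a b : ℝ) : CurveKind → ℝ → ℝ → ℝ
  | .openArc, s, t => |s - t|
  | .closedCurve, s, t => |s - t| * |(s - t) ^ 2 - (b - a) ^ 2| / (b - a) ^ 2

/-- The auxiliary function as a function on the extended parameter line: for closed curves a function
on `[a, b]` is continued with period `b - a`. -/
noncomputable def auxFun (a b : ℝ) (c : CurveKind) (g : ℝ → ℝ) : ℝ → ℝ :=
  match c with
  | .openArc => g
  | .closedCurve => fun t =>
      open Classical in
      if t ∈ Set.Icc a b then g t else g (t - (b - a) * (⌊(t - a) / (b - a)⌋ : ℝ))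

/-- The error `e = I_{B_i}[g] - I^Q_{B_i}[g]` of the regular rule. -/
noncomputable def errReg {a b : ℝ} (H : Hierarchy a b) (c : CurveKind) (d ℓ : ℕ) (m : ℤ)
    (p n : ℕ) (S : ℕ → Finset ℕ) (g : ℝ → ℝ) : ℝ :=
  (∫ t in H.supp c d ℓ m, H.B c d ℓ m t * g t)
    - qiRule (H.left c ℓ m) (H.right c d ℓ m) p n S (H.B c d ℓ m) g

/-- The error `E = I_{w_i^s}[g] - I^Q_{w_i^s}[g]` of the rule with the weight
`w_i^s(t) = log δ(s, t) B_i(t)`. -/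
noncomputable def errSing {a b : ℝ} (H : Hierarchy a b) (c : CurveKind) (d ℓ : ℕ) (m : ℤ)
    (p n : ℕ) (S : ℕ → Finset ℕ) (g : ℝ → ℝ) (s : ℝ) : ℝ :=
  (∫ t in H.supp c d ℓ m, Real.log (delta a b c s t) * H.B c d ℓ m t * g t)
    - qiRule (H.left c ℓ m) (H.right c d ℓ m) p n S
        (fun t => Real.log (delta a b c s t) * H.B c d ℓ m t) g

/-- The norm `‖D^r g‖_{L^∞(D)}` of a function that is `r` times continuously differentiable on the
compact interval `D`. -/
noncomputable def derivSupNorm (r : ℕ) (g : ℝ → ℝ) (D : Set ℝ) : ℝ :=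
  sSup ((fun t => |iteratedDerivWithin r g D t|) '' D)

end QIQuad

/-!
The error functional of the rule annihilates polynomials of degree at most `p`, and it is bounded by
a constant times `∫ |w|` in the sup norm on `D_i`, where `w` is the weight. Subtracting the Taylor
polynomial of degree `p` at the left end of `D_i` (`exists_polynomial_near`) therefore gives an error
`O(h ^ (p + 1)) * ‖D^{p+1} g‖ * ∫ |w|` (`abs_integral_sub_qiRule_le`). As `D_i` has length at most
`(d + 1) h`, the last factor is `O(h)` for `w = B_i`, and `O(h |log h|)` for `w = B_i * log δ(s, ·)`,
uniformly in `s` (`setIntegral_abs_log_delta_le`).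

The exactness on polynomials is the main point. By Marsden's identity all monomials of degree at most
`p`, and all truncated powers at the interior breakpoints, are combinations of the reference
B-splines; these families have the same number of elements, so that conversely each B-spline is a
combination of monomials and truncated powers (`exists_refBspline_eq`), in particular differentiable
for `p ≥ 2`. If the local `2p × 2p` systems are nonsingular, then the coefficient functionals are dual
to the B-splines (`hermiteFunctional_bsCoeff`), and they reproduce the whole spline space; the finite
differences are exact for polynomials of degree at most `p`, so that `σ_q = q` for these.

Nonsingularity (`det_bsMatrix_ne_zero`): a vector in the kernel is a functional
`∑ α_r f (i + r) - ∑ β_r f' (i + r)` on `p` consecutive nodes with `∑ β_r = 0` that annihilates all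
B-splines, hence all truncated powers `(t - k)_+ ^ p` with integer `k`. With the generating polynomials
`A`, `B` of `α`, `β` and `∑ j ^ m x ^ j = P_m (x) / (1 - x) ^ (m + 1)` this reads
`A P_p = p (1 - x) B P_{p-1}`. By Rolle's theorem the Eulerian numerator `P_p` has `p - 1` distinct
nonzero roots that are not roots of `P_{p-1}` (`exists_roots_eulerPoly`); these are roots of `B`,
which also vanishes at `1` and has degree at most `p - 1`. So `B = 0` and `A = 0`
(`functional_eq_zero`).
-/

namespace QIQuad

/-! ### B-splines: support and reproduction of polynomials -/

section Support

variable {T : ℤ → ℝ}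

theorem bspline_eq_zero_of_lt (hT : Monotone T) {t : ℝ} (r : ℕ) :
    ∀ {i : ℤ}, t < T i → bspline T r i t = 0 := by
  induction r with
  | zero =>
    intro i h
    simp only [bspline]
    rw [if_neg]
    rintro ⟨-, h', -⟩
    linarith
  | succ r ih =>
    intro i h
    have h' : t < T (i + 1) := h.trans_le (hT (by omega))
    simp [bspline, ih h, ih h']

theorem bspline_eq_zero_of_le (hT : Monotone T) {t : ℝ} (r : ℕ) :
    ∀ {i k : ℤ}, T (i + r + 1) ≤ t → T (i + r + 1) < T k → bspline T r i t = 0 := by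
  induction r with
  | zero =>
    intro i k h hk
    simp only [bspline]
    rw [if_neg]
    simp only [Nat.cast_zero, add_zero] at h hk
    rintro ⟨-, -, h' | ⟨-, h'⟩⟩
    · linarith
    · linarith [h' k]
  | succ r ih =>
    intro i k h hk
    push_cast at h hk
    have e : T (i + r + 1) ≤ T (i + (r + 1) + 1) := hT (by omega)
    have e' : i + 1 + r + 1 = i + (r + 1) + 1 := by ring
    have h1 := ih (i := i) (e.trans h) (e.trans_lt hk)
    have h2 := ih (i := i + 1) (k := k) (by rwa [e']) (by rwa [e'])
    simp [bspline, h1, h2]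

theorem bspline_eq_zero_of_knots_eq (hT : Monotone T) {t : ℝ} (r : ℕ) :
    ∀ {i : ℤ}, T i = T (i + r + 1) → bspline T r i t = 0 := by
  induction r with
  | zero =>
    intro i h
    simp only [Nat.cast_zero, add_zero] at h
    simp [bspline, ← h]
  | succ r ih =>
    intro i h
    push_cast at h
    have a1 : T i ≤ T (i + 1) := hT (by omega)
    have a2 : T (i + 1) ≤ T (i + r + 1) := hT (by omega)
    have a3 : T (i + r + 1) ≤ T (i + (r + 1) + 1) := hT (by omega)
    have e' : i + 1 + r + 1 = i + (r + 1) + 1 := by ring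
    have h1 := ih (i := i) (by linarith)
    have h2 := ih (i := i + 1) (by rw [e']; linarith)
    simp [bspline, h1, h2]

/-- A crude bound, which suffices since only the ratio `K` of the length of the support to the
smallest knot distance `h` enters. -/
theorem abs_bspline_le {h K t : ℝ} (hh : 0 < h)
    (hgap : ∀ i j, T i < T j → h ≤ T j - T i) (r : ℕ) :
    ∀ {i : ℤ}, (∀ j, i ≤ j → j ≤ i + r + 1 → |t - T j| ≤ K * h) →
      |bspline T r i t| ≤ (2 * K + 1) ^ r := by
  induction r with
  | zero =>
    intro i _
    simp only [bspline, pow_zero]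
    split_ifs <;> simp
  | succ r ih =>
    intro i ht
    push_cast at ht
    have hK : 0 ≤ K := by
      have := (abs_nonneg _).trans (ht i le_rfl (by omega))
      exact nonneg_of_mul_nonneg_left this hh
    have hom : ∀ j, i ≤ j → j ≤ i + 1 → |omega T (r + 1) j t| ≤ K := by
      intro j h1 h2
      unfold omega
      split_ifs with hlt
      · have hg := hgap _ _ hlt
        rw [abs_div, abs_of_pos (by linarith : 0 < T (j + (r + 1 : ℕ)) - T j),
          div_le_iff₀ (by linarith)]
        exact (ht j h1 (by omega)).trans (by gcongr)
      · simpa using hK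
    have b1 := ih (i := i) fun j h1 h2 => ht j h1 (by omega)
    have b2 := ih (i := i + 1) fun j h1 h2 => ht j (by omega) (by omega)
    have o1 := hom i le_rfl (by omega)
    have o2 : |1 - omega T (r + 1) (i + 1) t| ≤ K + 1 := by
      refine (abs_sub _ _).trans ?_
      have := hom (i + 1) (by omega) le_rfl
      simp only [abs_one]
      linarith
    calc |bspline T (r + 1) i t|
        ≤ |omega T (r + 1) i t| * |bspline T r i t|
          + |1 - omega T (r + 1) (i + 1) t| * |bspline T r (i + 1) t| := by
          rw [← abs_mul, ← abs_mul]; exact abs_add_le _ _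
      _ ≤ K * (2 * K + 1) ^ r + (K + 1) * (2 * K + 1) ^ r := by gcongr
      _ = (2 * K + 1) ^ (r + 1) := by ring

theorem measurable_bspline (T : ℤ → ℝ) (r : ℕ) : ∀ i, Measurable (bspline T r i) := by
  induction r with
  | zero =>
    intro i
    have : bspline T 0 i = Set.indicator {t | T i < T (i + 1) ∧ T i ≤ t ∧
        (t < T (i + 1) ∨ (t = T (i + 1) ∧ ∀ k, T k ≤ T (i + 1)))} 1 := by
      ext t
      simp only [bspline, Set.indicator, Set.mem_ofPred_eq, Pi.one_apply]
      congr
    rw [this]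
    refine measurable_one.indicator ?_
    refine (MeasurableSet.const _).inter (measurableSet_Ici.inter ?_)
    exact measurableSet_Iio.union ((measurableSet_singleton _).inter (MeasurableSet.const _))
  | succ r ih =>
    intro i
    have ho : ∀ j, Measurable (omega T (r + 1) j) := by
      intro j
      unfold omega
      split_ifs <;> fun_prop
    exact ((ho i).mul (ih i)).add ((measurable_const.sub (ho (i + 1))).mul (ih (i + 1)))

/-- B-splines are invariant under increasing affine maps of the knots and the argument. -/
theorem bspline_affine {x h : ℝ} (hh : 0 < h) (T : ℤ → ℝ) (t : ℝ) (r : ℕ) :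
    ∀ i, bspline (fun k => x + h * T k) r i (x + h * t) = bspline T r i t := by
  induction r with
  | zero =>
    intro i
    simp only [bspline]
    classical
    refine if_congr ?_ rfl rfl
    simp [hh, hh.ne']
  | succ r ih =>
    intro i
    have ho : ∀ j, omega (fun k => x + h * T k) (r + 1) j (x + h * t) = omega T (r + 1) j t := by
      intro j
      simp only [omega, add_lt_add_iff_left, mul_lt_mul_iff_right₀ hh, add_sub_add_left_eq_sub,
        ← mul_sub]
      rw [mul_div_mul_left _ _ hh.ne']
    simp only [bspline, ho, ih]

end Support

section Clamped

theorem clampedKnots_zero_one (n : ℕ) (m : ℤ) :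
    clampedKnots 0 1 n m = ((max 0 (min m (n : ℤ)) : ℤ) : ℝ) := by
  simp only [clampedKnots, zero_add, one_mul]

theorem monotone_clampedKnots {x h : ℝ} (hh : 0 ≤ h) (n : ℕ) : Monotone (clampedKnots x h n) := by
  intro i j hij
  unfold clampedKnots
  have : max 0 (min i (n : ℤ)) ≤ max 0 (min j (n : ℤ)) := by omega
  have : ((max 0 (min i (n : ℤ)) : ℤ) : ℝ) ≤ ((max 0 (min j (n : ℤ)) : ℤ) : ℝ) := by
    exact_mod_cast this
  gcongr

theorem clampedKnots_of_mem {n : ℕ} {m : ℤ} (h0 : 0 ≤ m) (h1 : m ≤ n) :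
    clampedKnots 0 1 n m = m := by
  rw [clampedKnots_zero_one]
  congr 1
  omega

/-- The reference B-spline: degree `p`, index `m`, on the clamped knot vector with the breakpoints
`0, 1, …, n`. -/
noncomputable abbrev refBspline (p n : ℕ) (m : ℤ) : ℝ → ℝ := bspline (clampedKnots 0 1 n) p m

theorem refBspline_of_le {p n : ℕ} {m : ℤ} (hm : m + p + 1 ≤ 0) (t : ℝ) :
    refBspline p n m t = 0 := by
  refine bspline_eq_zero_of_knots_eq (monotone_clampedKnots zero_le_one n) p ?_
  rw [clampedKnots_zero_one, clampedKnots_zero_one]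
  congr 1
  omega

theorem refBspline_of_ge {p n : ℕ} {m : ℤ} (hm : (n : ℤ) ≤ m) (t : ℝ) :
    refBspline p n m t = 0 := by
  refine bspline_eq_zero_of_knots_eq (monotone_clampedKnots zero_le_one n) p ?_
  rw [clampedKnots_zero_one, clampedKnots_zero_one]
  congr 1
  omega

theorem sum_Ico_shift {a b : ℤ} (hab : a ≤ b) (f : ℤ → ℝ) (ha : f a = 0) (hb : f b = 0) :
    ∑ m ∈ Finset.Ico a b, f (m + 1) = ∑ m ∈ Finset.Ico a b, f m := by
  rw [Finset.sum_Ico_add' f a b 1]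
  trans ∑ m ∈ Finset.Ico a (b + 1), f m
  · refine Finset.sum_subset (Finset.Ico_subset_Ico (by omega) le_rfl) ?_
    intro x hx hx'
    simp only [Finset.mem_Ico] at hx hx'
    obtain rfl : x = a := by omega
    exact ha
  · symm
    refine Finset.sum_subset (Finset.Ico_subset_Ico le_rfl (by omega)) ?_
    intro x hx hx'
    simp only [Finset.mem_Ico] at hx hx'
    obtain rfl : x = b := by omega
    exact hb

/-- Marsden's identity on the clamped knot vector. The range of summation contains all indices of
B-splines of degree `r` that do not vanish identically. -/
theorem marsden_eval {n : ℕ} (hn : 1 ≤ n) (N : ℕ) (τ : ℝ) {t : ℝ} (ht : t ∈ Set.Icc (0 : ℝ) n)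
    (r : ℕ) (hr : r ≤ N) :
    ∑ m ∈ Finset.Ico (-(N : ℤ)) n,
      (∏ l ∈ Finset.range r, (τ - clampedKnots 0 1 n (m + 1 + l))) * refBspline r n m t
      = (τ - t) ^ r := by
  have hmono := monotone_clampedKnots (x := 0) zero_le_one n
  induction r with
  | zero =>
    simp only [Finset.range_zero, Finset.prod_empty, one_mul, pow_zero]
    obtain ⟨m, hm0, hmn, hmt, hmt'⟩ : ∃ m : ℤ, 0 ≤ m ∧ m < n ∧ (m : ℝ) ≤ t ∧
        (t < m + 1 ∨ (t = m + 1 ∧ m + 1 = n)) := by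
      rcases ht.2.lt_or_eq with h | h
      · exact ⟨⌊t⌋, Int.floor_nonneg.2 ht.1, Int.floor_lt.2 (by exact_mod_cast h), Int.floor_le t,
          .inl (Int.lt_floor_add_one t)⟩
      · refine ⟨n - 1, by omega, by omega, ?_, .inr ⟨?_, by omega⟩⟩ <;> push_cast <;> linarith
    have hval : ∀ j : ℤ, 0 ≤ j → j ≤ n → clampedKnots 0 1 n j = j :=
      fun j h0 h1 => clampedKnots_of_mem h0 h1
    rw [Finset.sum_eq_single m]
    · simp only [refBspline, bspline]
      rw [if_pos]
      rw [hval m hm0 hmn.le, hval (m + 1) (by omega) (by omega)]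
      push_cast
      refine ⟨by linarith, hmt, hmt'.imp id fun h => ⟨h.1, fun k => ?_⟩⟩
      rw [clampedKnots_zero_one]
      have : max 0 (min k (n : ℤ)) ≤ m + 1 := by omega
      exact_mod_cast this
    · intro j hj hjm
      simp only [Finset.mem_Ico] at hj
      simp only [refBspline, bspline]
      rw [if_neg]
      rintro ⟨h1, h2, h3⟩
      have hj0 : 0 ≤ j := by
        by_contra hlt
        refine h1.ne ?_
        rw [clampedKnots_zero_one, clampedKnots_zero_one]
        congr 1
        omega
      rw [hval j hj0 hj.2.le] at h2
      rw [hval (j + 1) (by omega) (by omega)] at h3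
      push_cast at h3
      have a1 : j ≤ m := by
        rcases hmt' with h | ⟨h, h'⟩
        · have : (j : ℝ) < m + 1 := by linarith
          have : j < m + 1 := by exact_mod_cast this
          omega
        · omega
      have a2 : m ≤ j := by
        rcases h3 with h | ⟨h, h'⟩
        · have : (m : ℝ) < j + 1 := by linarith
          have : m < j + 1 := by exact_mod_cast this
          omega
        · have := h' n
          rw [hval n (by omega) le_rfl] at this
          have : (n : ℤ) ≤ j + 1 := by exact_mod_cast this
          omega
      omega
    · intro h
      exact absurd (Finset.mem_Ico.2 ⟨by omega, hmn⟩) h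
  | succ r ih =>
    rw [pow_succ, ← ih (by omega)]
    set T := clampedKnots 0 1 n with hT
    let P : ℤ → ℝ := fun m => ∏ l ∈ Finset.range (r + 1), (τ - T (m + 1 + l))
    have split : ∀ m, P m * refBspline (r + 1) n m t
        = P m * omega T (r + 1) m t * refBspline r n m t
          + P (m + 1 - 1) * (1 - omega T (r + 1) (m + 1) t) * refBspline r n (m + 1) t := by
      intro m
      simp only [refBspline, bspline, add_sub_cancel_right, ← hT]
      ring
    rw [Finset.sum_congr rfl fun m _ => split m, Finset.sum_add_distrib,
      sum_Ico_shift (by omega)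
        (fun m => P (m - 1) * (1 - omega T (r + 1) m t) * refBspline r n m t)
        (by simp [refBspline_of_le (p := r) (n := n) (m := -(N : ℤ)) (by omega)])
        (by simp [refBspline_of_ge (p := r) (n := n) (m := n) le_rfl]),
      ← Finset.sum_add_distrib, Finset.sum_mul]
    refine Finset.sum_congr rfl fun m _ => ?_
    rcases (hmono (by omega : m ≤ m + r + 1)).lt_or_eq with hlt | heq
    · have e1 : P m = (∏ l ∈ Finset.range r, (τ - T (m + 1 + l))) * (τ - T (m + r + 1)) := by
        simp only [P, Finset.prod_range_succ]
        congr 3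
        ring
      have e2 : P (m - 1) = (∏ l ∈ Finset.range r, (τ - T (m + 1 + l))) * (τ - T m) := by
        simp only [P, Finset.prod_range_succ']
        congr 1
        · refine Finset.prod_congr rfl fun l _ => ?_
          congr 2
          push_cast
          ring
        · simp
      have e3 : omega T (r + 1) m t = (t - T m) / (T (m + r + 1) - T m) := by
        unfold omega
        push_cast
        rw [← add_assoc, if_pos hlt]
      have e4 : T (m + r + 1) - T m ≠ 0 := by
        have : T m < T (m + r + 1) := hlt
        linarith
      rw [e1, e2, e3]
      field_simp
      ring
    · have := bspline_eq_zero_of_knots_eq (t := t) hmono r heq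
      simp [refBspline, ← hT, this]

/-- The polynomial `∏ (X - t_{m+l})`, `l = 1, …, p`, over the interior knots of a B-spline: the dual
polynomial that enters Marsden's identity. -/
noncomputable def dualPoly (p n : ℕ) (m : ℤ) : Polynomial ℝ :=
  ∏ l ∈ Finset.range p, (Polynomial.X - Polynomial.C (clampedKnots 0 1 n (m + 1 + l)))

theorem marsden {p n : ℕ} (hn : 1 ≤ n) {t : ℝ} (ht : t ∈ Set.Icc (0 : ℝ) n) :
    ∑ m ∈ Finset.Ico (-(p : ℤ)) n, Polynomial.C (refBspline p n m t) * dualPoly p n m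
      = (Polynomial.X + Polynomial.C (-t)) ^ p := by
  refine Polynomial.funext fun τ => ?_
  have := marsden_eval hn p τ ht p le_rfl
  simp only [dualPoly, Polynomial.eval_finsetSum, Polynomial.eval_mul, Polynomial.eval_C,
    Polynomial.eval_prod, Polynomial.eval_sub, Polynomial.eval_X, Polynomial.eval_pow,
    Polynomial.eval_add, ← sub_eq_add_neg]
  rw [← this]
  exact Finset.sum_congr rfl fun m _ => mul_comm _ _

/-- Monomials are combinations of B-splines: compare the coefficients in Marsden's identity. -/
theorem exists_coeff_monomial {p n : ℕ} (hn : 1 ≤ n) {q : ℕ} (hq : q ≤ p) :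
    ∃ c : ℤ → ℝ, ∀ t ∈ Set.Icc (0 : ℝ) n,
      t ^ q = ∑ m ∈ Finset.Ico (-(p : ℤ)) n, c m * refBspline p n m t := by
  refine ⟨fun m => (-1) ^ q * ((p.choose (p - q) : ℝ))⁻¹ * (dualPoly p n m).coeff (p - q),
    fun t ht => ?_⟩
  have h := congrArg (fun P => Polynomial.coeff P (p - q)) (marsden (p := p) hn ht)
  simp only [Polynomial.finsetSum_coeff, Polynomial.coeff_C_mul, Polynomial.coeff_X_add_C_pow] at h
  have hc : (p.choose (p - q) : ℝ) ≠ 0 := by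
    exact_mod_cast (Nat.choose_pos (Nat.sub_le p q)).ne'
  have e : ∀ m, (-1) ^ q * ((p.choose (p - q) : ℝ))⁻¹ * (dualPoly p n m).coeff (p - q)
        * refBspline p n m t
      = (-1) ^ q * ((p.choose (p - q) : ℝ))⁻¹ *
        (refBspline p n m t * (dualPoly p n m).coeff (p - q)) := fun m => by ring
  rw [Finset.sum_congr rfl fun m _ => e m, ← Finset.mul_sum, h, Nat.sub_sub_self hq, neg_pow t q]
  have : ((-1 : ℝ) ^ q) * (-1) ^ q = 1 := by rw [← mul_pow]; simp
  field_simp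
  linear_combination (-(t ^ q)) * this

/-- The truncated power `(t - k)_+ ^ p` at an interior breakpoint is a combination of B-splines:
in Marsden's identity at `τ = k` the coefficients of the B-splines with `k` as an interior knot
vanish, so that it splits into the parts left and right of `k`. -/
theorem exists_coeff_truncPow {p n : ℕ} (hp : 1 ≤ p) {k : ℕ} (hk : 1 ≤ k) (hkn : k + 1 ≤ n) :
    ∃ c : ℤ → ℝ, ∀ t ∈ Set.Icc (0 : ℝ) n,
      (max (t - k) 0) ^ p = ∑ m ∈ Finset.Ico (-(p : ℤ)) n, c m * refBspline p n m t := by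
  have hmono := monotone_clampedKnots (x := 0) zero_le_one n
  have hkk : clampedKnots 0 1 n k = k := by
    rw [clampedKnots_of_mem (by omega) (by omega)]
    simp
  refine ⟨fun m => if (k : ℤ) ≤ m then (-1) ^ p * (dualPoly p n m).eval (k : ℝ) else 0,
    fun t ht => ?_⟩
  rcases lt_or_ge t k with hlt | hge
  · rw [max_eq_right (by linarith), zero_pow (by omega), Finset.sum_eq_zero]
    intro m _
    dsimp only
    split_ifs with h
    · have h1 : t < clampedKnots 0 1 n m := lt_of_lt_of_le (by rwa [hkk]) (hmono h)
      simp [refBspline, bspline_eq_zero_of_lt hmono p h1]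
    · simp
  · rw [max_eq_left (by linarith)]
    have h := congrArg (Polynomial.eval (k : ℝ)) (marsden (p := p) (by omega) ht)
    simp only [Polynomial.eval_finsetSum, Polynomial.eval_mul, Polynomial.eval_C,
      Polynomial.eval_pow, Polynomial.eval_add, Polynomial.eval_X] at h
    have e : (t - k) ^ p = (-1) ^ p * ((k : ℝ) + -t) ^ p := by
      rw [← mul_pow]; congr 1; ring
    rw [e, ← h, Finset.mul_sum]
    refine Finset.sum_congr rfl fun m _ => ?_
    dsimp only
    split_ifs with hm
    · ring
    · simp only [zero_mul]
      by_cases hm' : m + p + 1 ≤ k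
      · have h1 : clampedKnots 0 1 n (m + p + 1) ≤ clampedKnots 0 1 n k := hmono hm'
        have h2 : clampedKnots 0 1 n (k : ℤ) < clampedKnots 0 1 n n := by
          rw [hkk, clampedKnots_of_mem (by omega) le_rfl]
          exact_mod_cast hkn
        have := bspline_eq_zero_of_le (t := t) hmono p (i := m) (k := n)
          (h1.trans (by rwa [hkk])) (h1.trans_lt h2)
        simp [refBspline, this]
      · have : (dualPoly p n m).eval (k : ℝ) = 0 := by
          simp only [dualPoly, Polynomial.eval_prod]
          refine Finset.prod_eq_zero (i := (k - (m + 1)).toNat) ?_ ?_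
          · simp only [Finset.mem_range]; omega
          · rw [Int.toNat_of_nonneg (by omega)]
            simp [hkk]
        simp [this]

end Clamped

/-! ### The spline space: monomials and truncated powers -/

/-- The monomials `t ^ q`, `q ≤ p`, and the truncated powers `(t - k)_+ ^ p`, `k = 1, …, n - 1`. -/
noncomputable def powFamily (p n : ℕ) : Fin (p + 1) ⊕ Fin (n - 1) → ℝ → ℝ
  | .inl q => fun t => t ^ (q : ℕ)
  | .inr k => fun t => (max (t - ((k : ℕ) + 1 : ℕ)) 0) ^ p

theorem linearIndependent_powFamily {p n : ℕ} (hp : 1 ≤ p) (hn : 1 ≤ n) :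
    LinearIndependent ℝ fun i (t : Set.Icc (0 : ℝ) n) => powFamily p n i t := by
  rw [Fintype.linearIndependent_iff]
  intro g hg
  have hg' : ∀ t ∈ Set.Icc (0 : ℝ) n, ∑ q : Fin (p + 1), g (.inl q) * t ^ (q : ℕ)
      + ∑ k : Fin (n - 1), g (.inr k) * (max (t - ((k : ℕ) + 1 : ℕ)) 0) ^ p = 0 := by
    intro t ht
    have := congrFun hg ⟨t, ht⟩
    simpa [Fintype.sum_sum_type, powFamily] using this
  -- On `[0, 1]` all truncated powers vanish.
  have hpoly : ∀ q : Fin (p + 1), g (.inl q) = 0 := by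
    let P : Polynomial ℝ := ∑ q : Fin (p + 1), Polynomial.C (g (.inl q)) * Polynomial.X ^ (q : ℕ)
    have hP : P = 0 := by
      refine Polynomial.eq_zero_of_infinite_isRoot P
        ((Set.Icc_infinite (zero_lt_one (α := ℝ))).mono fun t ht => ?_)
      have ht1 : t ∈ Set.Icc (0 : ℝ) n := ⟨ht.1, ht.2.trans (by exact_mod_cast hn)⟩
      have h := hg' t ht1
      rw [Finset.sum_eq_zero (s := (Finset.univ : Finset (Fin (n - 1)))), add_zero] at h
      · simpa [P, Polynomial.eval_finsetSum] using h
      · intro k _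
        rw [max_eq_right, zero_pow (by omega), mul_zero]
        have := ht.2
        push_cast
        linarith [(Nat.cast_nonneg (k : ℕ) : (0 : ℝ) ≤ _)]
    intro q
    have := congrArg (fun R => Polynomial.coeff R (q : ℕ)) hP
    simpa [P, Polynomial.finsetSum_coeff, Polynomial.coeff_X_pow, Fin.val_inj] using this
  have htrunc : ∀ j : ℕ, ∀ k : Fin (n - 1), (k : ℕ) = j → g (.inr k) = 0 := by
    intro j
    induction j using Nat.strong_induction_on with
    | _ j ih =>
      intro k hk
      have hkn := k.isLt
      -- At `t = k + 2` only the truncated powers up to the current one are nonzero.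
      have h := hg' ((k : ℕ) + 2 : ℕ)
        ⟨by positivity, by exact_mod_cast (by omega : (k : ℕ) + 2 ≤ n)⟩
      rw [Finset.sum_eq_zero (fun q _ => by rw [hpoly q, zero_mul]), zero_add,
        Finset.sum_eq_single k] at h
      · have e : (((k : ℕ) + 2 : ℕ) : ℝ) - ((k : ℕ) + 1 : ℕ) = 1 := by push_cast; ring
        rw [e] at h
        simpa using h
      · intro k' _ hne
        rcases lt_or_gt_of_ne hne with hlt | hgt
        · rw [ih k' (by rw [← hk]; exact hlt) k' rfl, zero_mul]
        · rw [max_eq_right, zero_pow (by omega), mul_zero]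
          have : (k : ℕ) + 1 ≤ k' := hgt
          have : ((k : ℕ) : ℝ) + 1 ≤ (k' : ℕ) := by exact_mod_cast this
          push_cast
          linarith
      · simp
  rintro (q | k)
  · exact hpoly q
  · exact htrunc k k rfl

theorem exists_refBspline_eq {p n : ℕ} (hp : 1 ≤ p) (hn : 1 ≤ n) {m : ℤ}
    (hm : m ∈ Finset.Ico (-(p : ℤ)) n) :
    ∃ c : Fin (p + 1) ⊕ Fin (n - 1) → ℝ, ∀ t ∈ Set.Icc (0 : ℝ) n,
      refBspline p n m t = ∑ i, c i * powFamily p n i t := by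
  let D := Set.Icc (0 : ℝ) n
  let b : Finset.Ico (-(p : ℤ)) n → D → ℝ := fun m t => refBspline p n m t
  let f : Fin (p + 1) ⊕ Fin (n - 1) → D → ℝ := fun i t => powFamily p n i t
  have hle : Submodule.span ℝ (Set.range f) ≤ Submodule.span ℝ (Set.range b) := by
    rw [Submodule.span_le]
    rintro _ ⟨i, rfl⟩
    obtain ⟨c, hc⟩ : ∃ c : ℤ → ℝ, ∀ t ∈ Set.Icc (0 : ℝ) n,
        powFamily p n i t = ∑ m ∈ Finset.Ico (-(p : ℤ)) n, c m * refBspline p n m t := by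
      rcases i with q | k
      · exact exists_coeff_monomial hn (by omega)
      · exact exists_coeff_truncPow hp (by omega) (by omega)
    rw [SetLike.mem_coe, Submodule.mem_span_range_iff_exists_fun]
    refine ⟨fun m => c m, ?_⟩
    ext t
    simp only [Finset.sum_apply, Pi.smul_apply, smul_eq_mul, f, b, hc t t.2]
    exact Finset.sum_coe_sort (Finset.Ico (-(p : ℤ)) n) (fun m => c m * refBspline p n m t)
  have hfin : Module.finrank ℝ (Submodule.span ℝ (Set.range b))
      ≤ Module.finrank ℝ (Submodule.span ℝ (Set.range f)) := by
    rw [finrank_span_eq_card (linearIndependent_powFamily hp hn)]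
    refine (finrank_range_le_card b).trans ?_
    simp only [Fintype.card_coe, Int.card_Ico, Fintype.card_sum, Fintype.card_fin]
    omega
  have := FiniteDimensional.span_of_finite ℝ (Set.finite_range b)
  have heq := Submodule.eq_of_le_of_finrank_le hle hfin
  have hmem : b ⟨m, hm⟩ ∈ Submodule.span ℝ (Set.range f) := by
    rw [heq]
    exact Submodule.subset_span ⟨_, rfl⟩
  obtain ⟨c, hc⟩ := Submodule.mem_span_range_iff_exists_fun (R := ℝ) |>.1 hmem
  refine ⟨c, fun t ht => ?_⟩
  have := congrFun hc ⟨t, ht⟩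
  simpa [f, b] using this.symm

theorem hasDerivAt_truncPow {p : ℕ} (hp : 2 ≤ p) (k t : ℝ) :
    HasDerivAt (fun t => (max (t - k) 0) ^ p) (p * (max (t - k) 0) ^ (p - 1)) t := by
  have hpoly : HasDerivAt (fun t : ℝ => (t - k) ^ p) (p * (t - k) ^ (p - 1)) t := by
    simpa using ((hasDerivAt_id t).sub_const k).fun_pow p
  have hzero : HasDerivAt (fun _ : ℝ => (0 : ℝ)) 0 t := hasDerivAt_const _ _
  have e0 : ∀ u ≤ k, (max (u - k) 0) ^ p = 0 := fun u hu => by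
    rw [max_eq_right (by linarith), zero_pow (by omega)]
  have e1 : ∀ u, k ≤ u → (max (u - k) 0) ^ p = (u - k) ^ p := fun u hu => by
    rw [max_eq_left (by linarith)]
  rcases lt_trichotomy t k with h | rfl | h
  · rw [max_eq_right (by linarith), zero_pow (by omega), mul_zero]
    refine hzero.congr_of_eventuallyEq ?_
    filter_upwards [Iio_mem_nhds h] with u hu using e0 u (le_of_lt hu)
  · rw [sub_self, zero_pow (by omega), mul_zero] at hpoly
    rw [sub_self, max_self, zero_pow (by omega), mul_zero, ← hasDerivWithinAt_univ,
      ← Set.Iic_union_Ici (a := t)]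
    exact (hzero.hasDerivWithinAt.congr (fun u hu => e0 u hu) (e0 t le_rfl)).union
      (hpoly.hasDerivWithinAt.congr (fun u hu => e1 u hu) (e1 t le_rfl))
  · rw [max_eq_left (by linarith)]
    refine hpoly.congr_of_eventuallyEq ?_
    filter_upwards [Ioi_mem_nhds h] with u hu using e1 u (le_of_lt hu)

theorem differentiable_powFamily {p n : ℕ} (hp : 2 ≤ p) (i : Fin (p + 1) ⊕ Fin (n - 1)) :
    Differentiable ℝ (powFamily p n i) := by
  rcases i with q | k
  · simp only [powFamily]; fun_prop
  · exact fun t => (hasDerivAt_truncPow hp _ t).differentiableAt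

theorem differentiableOn_refBspline {p n : ℕ} (hp : 2 ≤ p) (hn : 1 ≤ n) (m : ℤ) :
    DifferentiableOn ℝ (refBspline p n m) (Set.Icc 0 n) := by
  by_cases hm : m ∈ Finset.Ico (-(p : ℤ)) n
  · obtain ⟨c, hc⟩ := exists_refBspline_eq (by omega) hn hm
    refine DifferentiableOn.congr (f := fun t => ∑ i, c i * powFamily p n i t) ?_ hc
    have := differentiable_powFamily (p := p) (n := n) hp
    fun_prop
  · have : refBspline p n m = fun _ => 0 := by
      ext t
      rw [Finset.mem_Ico, not_and_or] at hm
      rcases hm with h | h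
      · exact refBspline_of_le (by omega) t
      · exact refBspline_of_ge (by omega) t
    rw [this]
    fun_prop

/-! ### Euler's power series and the functionals that annihilate all truncated powers -/

section Euler

open Polynomial

/-- The polynomials with `∑ j, j ^ m x ^ j = Q_m (1 / (1 - x))`: Eulerian polynomials in the variable
`u = 1 / (1 - x)`, in which the operator `x d/dx` becomes `u (u - 1) d/du`. -/
noncomputable def eulerPoly : ℕ → ℝ[X]
  | 0 => X
  | m + 1 => X * (X - 1) * derivative (eulerPoly m)

theorem eval_eulerPoly_succ (m : ℕ) (u : ℝ) :
    (eulerPoly (m + 1)).eval u = u * (u - 1) * (derivative (eulerPoly m)).eval u := by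
  simp [eulerPoly]

theorem natDegree_eulerPoly_le (m : ℕ) : (eulerPoly m).natDegree ≤ m + 1 := by
  induction m with
  | zero => simp [eulerPoly]
  | succ m ih =>
    have h1 : (X * (X - 1) : ℝ[X]).natDegree ≤ 2 := by compute_degree
    have h2 := natDegree_derivative_le (eulerPoly m)
    exact natDegree_mul_le.trans (by omega)

theorem isRoot_eulerPoly_zero_one (m : ℕ) :
    (eulerPoly (m + 1)).IsRoot 0 ∧ (eulerPoly (m + 1)).IsRoot 1 := by
  simp [eulerPoly, IsRoot.def]

/-- All roots of `eulerPoly m` are real and simple, by Rolle's theorem. -/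
theorem card_roots_eulerPoly (m : ℕ) : m + 1 ≤ (eulerPoly m).roots.toFinset.card := by
  induction m with
  | zero => simp [eulerPoly]
  | succ m ih =>
    rcases Nat.eq_zero_or_pos m with rfl | hm
    · have h : (X * (X - 1) : ℝ[X]) ≠ 0 := mul_ne_zero X_ne_zero (X_sub_C_ne_zero 1)
      have : ({0, 1} : Finset ℝ) ⊆ (eulerPoly (0 + 1)).roots.toFinset := by
        intro x hx
        rw [Finset.mem_insert, Finset.mem_singleton] at hx
        rw [Multiset.mem_toFinset, mem_roots (by simpa [eulerPoly] using h)]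
        rcases hx with rfl | rfl
        · exact (isRoot_eulerPoly_zero_one 0).1
        · exact (isRoot_eulerPoly_zero_one 0).2
      simpa using Finset.card_le_card this
    · obtain ⟨k, rfl⟩ : ∃ k, m = k + 1 := ⟨m - 1, by omega⟩
      set q := eulerPoly (k + 1) with hq
      have hcard := card_roots_toFinset_le_card_roots_derivative_sdiff_roots_succ q
      have hq0 : q ≠ 0 := by
        rintro h
        rw [h] at ih
        simp at ih
      set D := q.derivative.roots.toFinset \ q.roots.toFinset with hD
      have hDne : D.Nonempty := Finset.card_pos.1 (by omega)
      have hd0 : q.derivative ≠ 0 := by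
        rintro h
        rw [hD, h] at hDne
        simp at hDne
      have hne : eulerPoly (k + 1 + 1) ≠ 0 :=
        mul_ne_zero (mul_ne_zero X_ne_zero (X_sub_C_ne_zero 1)) hd0
      have hr := isRoot_eulerPoly_zero_one k
      have h0 : (0 : ℝ) ∉ D := fun h => (Finset.mem_sdiff.1 h).2
        (Multiset.mem_toFinset.2 ((mem_roots hq0).2 hr.1))
      have h1 : (1 : ℝ) ∉ D := fun h => (Finset.mem_sdiff.1 h).2
        (Multiset.mem_toFinset.2 ((mem_roots hq0).2 hr.2))
      have hsub : insert 0 (insert 1 D) ⊆ (eulerPoly (k + 1 + 1)).roots.toFinset := by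
        intro x hx
        rw [Finset.mem_insert, Finset.mem_insert] at hx
        rw [Multiset.mem_toFinset, mem_roots hne]
        rcases hx with rfl | rfl | hx
        · exact (isRoot_eulerPoly_zero_one _).1
        · exact (isRoot_eulerPoly_zero_one _).2
        · rw [hD, Finset.mem_sdiff, Multiset.mem_toFinset, mem_roots hd0] at hx
          have : eval x (derivative q) = 0 := hx.1
          rw [IsRoot.def, eval_eulerPoly_succ, ← hq, this, mul_zero]
      have := Finset.card_le_card hsub
      rw [Finset.card_insert_of_notMem (by simp [h0]), Finset.card_insert_of_notMem h1] at this
      omega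

/-- `eulerPoly (m + 2)` has `m + 1` distinct roots apart from `0` and `1`, none of which is a root of
`eulerPoly (m + 1)`. -/
theorem exists_roots_eulerPoly (m : ℕ) : ∃ R : Finset ℝ, m + 1 ≤ R.card ∧
    ∀ u ∈ R, u ≠ 0 ∧ (eulerPoly (m + 2)).eval u = 0 ∧ (eulerPoly (m + 1)).eval u ≠ 0 := by
  set q := eulerPoly (m + 1) with hq
  have h1 := card_roots_toFinset_le_card_roots_derivative_sdiff_roots_succ q
  have h2 := card_roots_eulerPoly (m + 1)
  have hq0 : q ≠ 0 := by
    rintro h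
    rw [← hq, h] at h2
    simp at h2
  refine ⟨q.derivative.roots.toFinset \ q.roots.toFinset, by rw [← hq] at h2; omega, fun u hu => ?_⟩
  rw [Finset.mem_sdiff, Multiset.mem_toFinset, Multiset.mem_toFinset, mem_roots hq0] at hu
  have hu1 : eval u (derivative q) = 0 := isRoot_of_mem_roots hu.1
  refine ⟨?_, by rw [eval_eulerPoly_succ, ← hq, hu1, mul_zero], hu.2⟩
  rintro rfl
  exact hu.2 (isRoot_eulerPoly_zero_one m).1

/-- The power series `∑ j, j ^ m X ^ j`. -/
noncomputable def powerSum (m : ℕ) : PowerSeries ℝ := PowerSeries.mk fun j => (j : ℝ) ^ m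

theorem powerSum_zero_mul : powerSum 0 * (1 - PowerSeries.X) = 1 := by
  have := PowerSeries.mk_one_mul_one_sub_eq_one ℝ
  simpa only [powerSum, pow_zero, Pi.one_def] using this

theorem powerSum_succ (m : ℕ) :
    powerSum (m + 1) = PowerSeries.X * PowerSeries.derivative ℝ (powerSum m) := by
  ext j
  cases j with
  | zero => simp [powerSum]
  | succ j =>
    rw [mul_comm, PowerSeries.coeff_succ_mul_X, PowerSeries.coeff_derivative]
    simp only [powerSum, PowerSeries.coeff_mk]
    push_cast
    ring

theorem powerSum_eq_aeval (m : ℕ) : powerSum m = aeval (powerSum 0) (eulerPoly m) := by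
  induction m with
  | zero => simp [eulerPoly]
  | succ m ih =>
    have hU := powerSum_zero_mul
    have hd : PowerSeries.derivative ℝ (powerSum 0) = powerSum 0 ^ 2 := by
      have h := congrArg (PowerSeries.derivative ℝ) hU
      rw [Derivation.leibniz] at h
      simp only [map_sub, Derivation.map_one_eq_zero, PowerSeries.derivative_X, smul_eq_mul,
        zero_sub] at h
      linear_combination (powerSum 0) * h
        - (PowerSeries.derivative ℝ (powerSum 0) - powerSum 0 ^ 2) * hU
        - powerSum 0 ^ 2 * hU
    rw [powerSum_succ, ih, Derivation.map_aeval, hd]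
    simp only [eulerPoly, map_mul, map_sub, aeval_X, map_one, smul_eq_mul]
    linear_combination (-powerSum 0 * aeval (powerSum 0) (derivative (eulerPoly m))) * hU

/-- The numerator in `∑ j, j ^ m x ^ j = P_m (x) / (1 - x) ^ (m + 1)`. -/
noncomputable def eulerNum (m : ℕ) : ℝ[X] := (reflect (m + 1) (eulerPoly m)).comp (1 - X)

theorem powerSum_mul_pow (m : ℕ) :
    powerSum m * (1 - PowerSeries.X) ^ (m + 1) = (eulerNum m : PowerSeries ℝ) := by
  have hU := powerSum_zero_mul
  let : Invertible (powerSum 0) := ⟨1 - PowerSeries.X, by rw [mul_comm, hU], hU⟩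
  have h := eval₂_reflect_mul_pow (algebraMap ℝ (PowerSeries ℝ)) (powerSum 0) (m + 1) (eulerPoly m)
    (natDegree_eulerPoly_le m)
  have h2 : (eulerNum m : PowerSeries ℝ)
      = eval₂ (algebraMap ℝ (PowerSeries ℝ)) (1 - PowerSeries.X) (reflect (m + 1) (eulerPoly m)) := by
    have e := Polynomial.hom_eval₂ (reflect (m + 1) (eulerPoly m)) C
      (coeToPowerSeries.ringHom (R := ℝ)) (1 - X)
    simp only [coeToPowerSeries.ringHom_apply, coe_sub, coe_one, coe_X] at e
    rw [eulerNum, comp, e]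
    congr 1
    ext r
    simp
  rw [powerSum_eq_aeval, aeval_def, ← h, h2, mul_assoc, ← mul_pow, hU, one_pow, mul_one]
  rfl

theorem eval_eulerNum {u : ℝ} (hu : u ≠ 0) (m : ℕ) :
    (eulerNum m).eval (1 - u⁻¹) * u ^ (m + 1) = (eulerPoly m).eval u := by
  let : Invertible u := invertibleOfNonzero hu
  have h := eval₂_reflect_mul_pow (RingHom.id ℝ) u (m + 1) (eulerPoly m) (natDegree_eulerPoly_le m)
  rw [eulerNum, eval_comp]
  simpa [eval₂_id, eval₂_eq_eval_map] using h

/-- A functional `∑ α_r f (r) - ∑ β_r f' (r)`, `0 ≤ r < p`, that annihilates all truncated powers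
`(t - k)_+ ^ p` with integer `k` and has `∑ β_r = 0` is zero. In terms of generating functions, the
hypothesis is the divisibility relation `A P_p = p (1 - X) B P_{p-1}` with the Eulerian numerators
`P_m`; the nonzero roots of `P_p` are not roots of `P_{p-1}`, so that they are roots of `B`, and `1`
is one more root of `B`: too many for its degree. -/
theorem functional_eq_zero {p : ℕ} (hp : 2 ≤ p) (α β : ℕ → ℝ)
    (h : ∀ k : ℤ, ∑ r ∈ Finset.range p, α r * (max ((r : ℝ) - k) 0) ^ p
      = ∑ r ∈ Finset.range p, β r * (p * (max ((r : ℝ) - k) 0) ^ (p - 1)))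
    (hβ : ∑ r ∈ Finset.range p, β r = 0) : ∀ r < p, α r = 0 ∧ β r = 0 := by
  let G : (ℕ → ℝ) → ℝ[X] := fun γ => ∑ r ∈ Finset.range p, C (γ r) * X ^ (p - 1 - r)
  have hG : ∀ γ, G γ = 0 → ∀ r < p, γ r = 0 := by
    intro γ hγ r hr
    have := congrArg (fun P => coeff P (p - 1 - r)) hγ
    simp only [G, finsetSum_coeff, coeff_C_mul, coeff_X_pow, coeff_zero] at this
    rw [Finset.sum_eq_single r] at this
    · simpa using this
    · intro r' hr' hne
      rw [Finset.mem_range] at hr'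
      rw [if_neg (by omega), mul_zero]
    · simp [hr]
  have hdeg : ∀ γ, (G γ).natDegree ≤ p - 1 := by
    intro γ
    refine natDegree_sum_le_of_forall_le _ _ fun r _ => ?_
    exact (natDegree_C_mul_X_pow_le _ _).trans (by omega)
  have hcoeff : ∀ γ : ℕ → ℝ, ∀ m, 1 ≤ m → ∀ N : ℕ,
      PowerSeries.coeff N ((G γ : PowerSeries ℝ) * powerSum m)
        = ∑ r ∈ Finset.range p, γ r * (max ((r : ℝ) - ((p - 1 - N : ℤ) : ℝ)) 0) ^ m := by
    intro γ m hm N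
    have e : (G γ : PowerSeries ℝ) = ∑ r ∈ Finset.range p,
        PowerSeries.C (γ r) * PowerSeries.X ^ (p - 1 - r) := by
      simp only [G]
      rw [← coeToPowerSeries.ringHom_apply, map_sum]
      simp
    rw [e, Finset.sum_mul, map_sum]
    refine Finset.sum_congr rfl fun r hr => ?_
    rw [Finset.mem_range] at hr
    rw [mul_assoc, PowerSeries.coeff_C_mul, PowerSeries.coeff_X_pow_mul']
    congr 1
    have e1 : (r : ℝ) - ((p - 1 - N : ℤ) : ℝ) = ((N : ℤ) - ((p - 1 - r : ℕ) : ℤ) : ℤ) := by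
      have : ((p - 1 - r : ℕ) : ℤ) = p - 1 - r := by omega
      rw [this]
      push_cast
      ring
    rw [e1]
    split_ifs with hle
    · rw [max_eq_left (by exact_mod_cast (by omega : (0 : ℤ) ≤ (N : ℤ) - ((p - 1 - r : ℕ) : ℤ)))]
      simp only [powerSum, PowerSeries.coeff_mk]
      rw [Nat.cast_sub hle]
      push_cast
      rfl
    · rw [max_eq_right (by exact_mod_cast (by omega : (N : ℤ) - ((p - 1 - r : ℕ) : ℤ) ≤ 0)),
        zero_pow (by omega)]
  have hser : (G α : PowerSeries ℝ) * powerSum p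
      = PowerSeries.C (p : ℝ) * ((G β : PowerSeries ℝ) * powerSum (p - 1)) := by
    ext N
    rw [PowerSeries.coeff_C_mul, hcoeff α p (by omega), hcoeff β (p - 1) (by omega), h,
      Finset.mul_sum]
    exact Finset.sum_congr rfl fun r _ => by ring
  have hpoly : G α * eulerNum p = C (p : ℝ) * (G β * eulerNum (p - 1)) * (1 - X) := by
    rw [← coe_inj]
    push_cast
    rw [← powerSum_mul_pow, ← powerSum_mul_pow, show p - 1 + 1 = p by omega]
    linear_combination (1 - PowerSeries.X) ^ (p + 1) * hser
  obtain ⟨R, hRcard, hR⟩ := exists_roots_eulerPoly (p - 2)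
  rw [show p - 2 + 2 = p by omega, show p - 2 + 1 = p - 1 by omega] at hR
  have hB : G β = 0 := by
    let f : ℝ → ℝ := fun u => 1 - u⁻¹
    have hf : Function.Injective f := fun u v huv => by
      have : u⁻¹ = v⁻¹ := by simp only [f] at huv; linarith
      exact inv_injective this
    refine eq_zero_of_natDegree_lt_card_of_eval_eq_zero' (G β) (insert 1 (R.image f)) ?_ ?_
    · intro x hx
      rw [Finset.mem_insert, Finset.mem_image] at hx
      rcases hx with rfl | ⟨u, hu, rfl⟩
      · simpa [G, eval_finsetSum] using hβ
      · obtain ⟨hu0, h1, h2⟩ := hR u hu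
        rw [← eval_eulerNum hu0] at h1 h2
        have hup : u ^ (p + 1) ≠ 0 := pow_ne_zero _ hu0
        have h3 := congrArg (eval (1 - u⁻¹)) hpoly
        simp only [eval_mul, eval_C, eval_sub, eval_one, eval_X] at h3
        rw [(mul_eq_zero.1 h1).resolve_right hup, mul_zero] at h3
        have hp0 : (p : ℝ) ≠ 0 := by positivity
        have hu' : 1 - (1 - u⁻¹) ≠ 0 := by simpa using hu0
        have h4 := ((mul_eq_zero.1 ((mul_eq_zero.1 h3.symm).resolve_right hu')).resolve_left hp0)
        exact (mul_eq_zero.1 h4).resolve_right (left_ne_zero_of_mul h2)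
    · rw [Finset.card_insert_of_notMem, Finset.card_image_of_injective _ hf]
      · have := hdeg β
        omega
      · rw [Finset.mem_image]
        rintro ⟨u, hu, hu'⟩
        have := (hR u hu).1
        simp only [f] at hu'
        exact inv_ne_zero this (by linarith)
  have hP : eulerNum p ≠ 0 := by
    intro h0
    have h1 := powerSum_mul_pow p
    rw [h0, coe_zero, mul_eq_zero] at h1
    have hX : (1 - PowerSeries.X : PowerSeries ℝ) ≠ 0 :=
      right_ne_zero_of_mul_eq_one powerSum_zero_mul
    have h2 := congrArg (PowerSeries.coeff 1) (h1.resolve_right (pow_ne_zero _ hX))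
    simp [powerSum] at h2
  have hA : G α = 0 := by
    rw [hB] at hpoly
    simpa [hP] using hpoly
  exact fun r hr => ⟨hG α hA r hr, hG β hB r hr⟩

end Euler

/-! ### The local linear systems -/

section VanishingAtEnds

theorem bspline_left_knot {T : ℤ → ℝ} (hT : Monotone T) (r : ℕ) {i : ℤ} (h : T i < T (i + 1)) :
    bspline T (r + 1) i (T i) = 0 := by
  have h1 : omega T (r + 1) i (T i) = 0 := by simp [omega]
  simp [bspline, h1, bspline_eq_zero_of_lt hT r h]

theorem bspline_right_knot {T : ℤ → ℝ} (hT : Monotone T) (r : ℕ) {i : ℤ}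
    (h : T (i + r + 1) < T (i + r + 2)) : bspline T (r + 1) i (T (i + r + 2)) = 0 := by
  have e : i + 1 + ((r + 1 : ℕ) : ℤ) = i + r + 2 := by push_cast; ring
  have hlt : T (i + 1) < T (i + r + 2) := (hT (by omega)).trans_lt h
  have h1 : omega T (r + 1) (i + 1) (T (i + r + 2)) = 1 := by
    unfold omega
    rw [e, if_pos hlt, div_self (by linarith)]
  simp [bspline, h1, bspline_eq_zero_of_le hT r h.le h]

variable {p n : ℕ} {m : ℤ}

theorem refBspline_eq_zero_left (hp : 1 ≤ p) (hm0 : 0 ≤ m) (hmn : m < n) {t : ℝ} (ht : t ≤ m) :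
    refBspline p n m t = 0 := by
  have hmono := monotone_clampedKnots (x := 0) zero_le_one n
  have e : clampedKnots 0 1 n m = m := clampedKnots_of_mem hm0 hmn.le
  obtain ⟨p, rfl⟩ : ∃ q, p = q + 1 := ⟨p - 1, by omega⟩
  rcases ht.lt_or_eq with h | h
  · exact bspline_eq_zero_of_lt hmono _ (by rwa [e])
  · rw [h, ← e]
    refine bspline_left_knot hmono p ?_
    rw [e, clampedKnots_of_mem (by omega) (by omega)]
    push_cast
    linarith

theorem refBspline_eq_zero_right (hp : 1 ≤ p) (hm : -(p : ℤ) ≤ m) (hmn : m + p + 1 ≤ n) {t : ℝ}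
    (ht : ((m + p + 1 : ℤ) : ℝ) ≤ t) (htn : t ≤ n) : refBspline p n m t = 0 := by
  have hmono := monotone_clampedKnots (x := 0) zero_le_one n
  have e : clampedKnots 0 1 n (m + p + 1) = (m + p + 1 : ℤ) := clampedKnots_of_mem (by omega) hmn
  rcases hmn.lt_or_eq with h | h
  · refine bspline_eq_zero_of_le hmono p (k := n) (by rwa [e]) ?_
    rw [e, clampedKnots_of_mem (by omega) le_rfl]
    exact_mod_cast h
  · obtain ⟨p, rfl⟩ : ∃ q, p = q + 1 := ⟨p - 1, by omega⟩
    have ht' : t = clampedKnots 0 1 n (m + p + 2) := by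
      rw [show m + p + 2 = m + (p + 1 : ℕ) + 1 by push_cast; ring, e]
      refine le_antisymm ?_ ht
      rw [h]
      exact_mod_cast htn
    rw [ht']
    refine bspline_right_knot hmono p ?_
    push_cast at h
    rw [clampedKnots_of_mem (by omega) (by omega), clampedKnots_of_mem (by omega) (by omega)]
    push_cast
    linarith

theorem derivWithin_eq_zero_of_subinterval {f : ℝ → ℝ} {s : Set ℝ} {u v x : ℝ} (huv : u < v)
    (hs : Set.Icc u v ⊆ s) (hf : DifferentiableOn ℝ f s) (h0 : ∀ t ∈ Set.Icc u v, f t = 0)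
    (hx : x ∈ Set.Icc u v) : derivWithin f s x = 0 := by
  have h1 := ((hf x (hs hx)).hasDerivWithinAt).mono hs
  have h2 : HasDerivWithinAt f 0 (Set.Icc u v) x :=
    (hasDerivWithinAt_const x _ (0 : ℝ)).congr h0 (h0 x hx)
  exact (uniqueDiffOn_Icc huv x hx).eq_deriv _ h1 h2

end VanishingAtEnds

/-- The functional `f ↦ ∑ α_r f (i + r) - ∑ β_r f' (i + r)` with the weights `v = (α, β)`. -/
noncomputable def hermiteFunctional (p n i : ℕ) (v : Fin (2 * p) → ℝ) (f : ℝ → ℝ) : ℝ :=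
  ∑ col : Fin (2 * p),
    (if (col : ℕ) < p then f ((i + (col : ℕ) : ℕ) : ℝ)
      else - derivWithin f (Set.Icc 0 (n : ℝ)) ((i + ((col : ℕ) - p) : ℕ) : ℝ)) * v col

/-- The sum of the derivative weights of a functional. -/
noncomputable def derivWeightSum (p : ℕ) (v : Fin (2 * p) → ℝ) : ℝ :=
  ∑ col : Fin (2 * p), (if (col : ℕ) < p then 0 else 1) * v col

section Functional

variable {p n i : ℕ} {v : Fin (2 * p) → ℝ}

theorem bsMatrix_mulVec_of_lt (row : Fin (2 * p)) (hrow : (row : ℕ) + 1 < 2 * p) :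
    (bsMatrix p n i).mulVec v row
      = hermiteFunctional p n i v (refBspline p n ((i : ℤ) - p + (row : ℕ))) := by
  simp only [Matrix.mulVec, dotProduct, bsMatrix, Matrix.of_apply, hermiteFunctional, if_pos hrow]

theorem bsMatrix_mulVec_last (row : Fin (2 * p)) (hrow : ¬ (row : ℕ) + 1 < 2 * p) :
    (bsMatrix p n i).mulVec v row = derivWeightSum p v := by
  simp only [Matrix.mulVec, dotProduct, bsMatrix, Matrix.of_apply, derivWeightSum, if_neg hrow]

theorem node_mem_Icc (hi : i + p ≤ n + 1) {r : ℕ} (hr : r < p) :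
    ((i + r : ℕ) : ℝ) ∈ Set.Icc (0 : ℝ) n :=
  ⟨by positivity, by exact_mod_cast (by omega : i + r ≤ n)⟩

/-- For `p = 1` the B-splines are not differentiable at the nodes, but then the normalization
already forces the only derivative weight to vanish. -/
theorem hermiteFunctional_sum {ι : Type*} (s : Finset ι) (c : ι → ℝ) (f : ι → ℝ → ℝ) {g : ℝ → ℝ}
    (hn : 1 ≤ n) (hi : i + p ≤ n + 1)
    (h : (∀ col : Fin (2 * p), p ≤ (col : ℕ) → v col = 0) ∨
      ∀ j ∈ s, DifferentiableOn ℝ (f j) (Set.Icc 0 n))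
    (hg : ∀ t ∈ Set.Icc (0 : ℝ) n, g t = ∑ j ∈ s, c j * f j t) :
    hermiteFunctional p n i v g = ∑ j ∈ s, c j * hermiteFunctional p n i v (f j) := by
  have hcol : ∀ col : Fin (2 * p),
      (if (col : ℕ) < p then g ((i + (col : ℕ) : ℕ) : ℝ)
        else - derivWithin g (Set.Icc 0 (n : ℝ)) ((i + ((col : ℕ) - p) : ℕ) : ℝ)) * v col
      = ∑ j ∈ s, c j * ((if (col : ℕ) < p then f j ((i + (col : ℕ) : ℕ) : ℝ)
        else - derivWithin (f j) (Set.Icc 0 (n : ℝ)) ((i + ((col : ℕ) - p) : ℕ) : ℝ)) * v col) := by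
    intro col
    split_ifs with hlt
    · rw [hg _ (node_mem_Icc hi hlt), Finset.sum_mul]
      exact Finset.sum_congr rfl fun j _ => by ring
    · rcases h with h | h
      · simp [h col (by omega)]
      · have hx := node_mem_Icc (r := (col : ℕ) - p) hi (by omega)
        set x : ℝ := ((i + ((col : ℕ) - p) : ℕ) : ℝ)
        have h1 : HasDerivWithinAt g (∑ j ∈ s, c j * derivWithin (f j) (Set.Icc 0 (n : ℝ)) x)
            (Set.Icc 0 (n : ℝ)) x := by
          refine HasDerivWithinAt.congr (f := fun t => ∑ j ∈ s, c j * f j t) ?_ hg (hg x hx)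
          exact HasDerivWithinAt.fun_sum fun j hj =>
            ((h j hj x hx).hasDerivWithinAt).const_mul (c j)
        rw [h1.derivWithin (uniqueDiffOn_Icc (by exact_mod_cast hn) x hx), ← Finset.sum_neg_distrib,
          Finset.sum_mul]
        exact Finset.sum_congr rfl fun j _ => by ring
  unfold hermiteFunctional
  rw [Finset.sum_congr rfl fun col _ => hcol col, Finset.sum_comm]
  exact Finset.sum_congr rfl fun j _ => (Finset.mul_sum _ _ _).symm

theorem derivWeight_eq_zero_of_one {v : Fin (2 * 1) → ℝ} (hv : derivWeightSum 1 v = 0)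
    (col : Fin (2 * 1)) (hcol : 1 ≤ (col : ℕ)) : v col = 0 := by
  rw [derivWeightSum, Fin.sum_univ_two] at hv
  have : col = 1 := Fin.ext (by have := col.isLt; simp; omega)
  subst this
  simpa using hv

theorem derivWeight_or_differentiableOn (hp : 1 ≤ p) (hn : 1 ≤ n) (hv : derivWeightSum p v = 0) :
    (∀ col : Fin (2 * p), p ≤ (col : ℕ) → v col = 0) ∨
      ∀ m : ℤ, DifferentiableOn ℝ (refBspline p n m) (Set.Icc 0 n) := by
  rcases hp.lt_or_eq with h | rfl
  · exact .inr fun m => differentiableOn_refBspline h hn m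
  · exact .inl fun col hcol => derivWeight_eq_zero_of_one hv col hcol

/-- The functional on the nodes `i, …, i + p - 1` only sees the B-splines with index
`i - p, …, i + p - 2`. -/
theorem hermiteFunctional_refBspline_eq_zero (hp : 1 ≤ p) (hi : i + p ≤ n + 1) (hpn : p ≤ n)
    (hv : derivWeightSum p v = 0) {m : ℤ} (hm : -(p : ℤ) ≤ m) (hmn : m < n)
    (hout : m < (i : ℤ) - p ∨ (i : ℤ) + p - 1 ≤ m) :
    hermiteFunctional p n i v (refBspline p n m) = 0 := by
  have hn : 1 ≤ n := hp.trans hpn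
  -- The B-spline vanishes on a closed interval that contains all the nodes.
  obtain ⟨x, y, hxy, h0, hy, hix, hiy, hz⟩ : ∃ x y : ℝ, (2 ≤ p → x < y) ∧ 0 ≤ x ∧ y ≤ n ∧ x ≤ i ∧
      (i : ℝ) + p - 1 ≤ y ∧ ∀ t ∈ Set.Icc x y, refBspline p n m t = 0 := by
    have hiR : (i : ℝ) + p ≤ n + 1 := by exact_mod_cast hi
    rcases hout with h | h
    · refine ⟨i, n, fun h2 => by exact_mod_cast (by omega : i < n), by positivity, le_rfl, le_rfl,
        by linarith, fun t ht => ?_⟩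
      refine refBspline_eq_zero_right hp hm (by omega) (le_trans ?_ ht.1) ht.2
      exact_mod_cast (by omega : m + p + 1 ≤ i)
    · refine ⟨0, i + p - 1, fun h2 => ?_, le_rfl, by linarith, by positivity, le_rfl,
        fun t ht => ?_⟩
      · have : (2 : ℝ) ≤ p := by exact_mod_cast h2
        linarith [(Nat.cast_nonneg i : (0 : ℝ) ≤ i)]
      · refine refBspline_eq_zero_left hp (by omega) hmn (ht.2.trans ?_)
        have : ((i : ℤ) + p - 1 : ℤ) ≤ m := h
        have : (((i : ℤ) + p - 1 : ℤ) : ℝ) ≤ m := by exact_mod_cast this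
        push_cast at this
        exact this
  have hnode : ∀ r < p, ((i + r : ℕ) : ℝ) ∈ Set.Icc x y := by
    intro r hr
    have h1 : (r : ℝ) + 1 ≤ p := by exact_mod_cast hr
    have h2 : (0 : ℝ) ≤ r := by positivity
    push_cast
    exact ⟨by linarith, by linarith⟩
  refine Finset.sum_eq_zero fun col _ => ?_
  split_ifs with hlt
  · rw [hz _ (hnode _ hlt), zero_mul]
  · rcases hp.lt_or_eq with h2 | rfl
    · rw [derivWithin_eq_zero_of_subinterval (hxy h2) (Set.Icc_subset_Icc h0 hy)
        (differentiableOn_refBspline h2 hn m) hz (hnode _ (by omega)), neg_zero, zero_mul]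
    · rw [derivWeight_eq_zero_of_one hv col (by omega), mul_zero]

theorem hermiteFunctional_of_hasDerivAt (hn : 1 ≤ n) (hi : i + p ≤ n + 1) {f f' : ℝ → ℝ}
    (hf : ∀ t, HasDerivAt f (f' t) t) :
    hermiteFunctional p n i v f = ∑ col : Fin (2 * p),
      (if (col : ℕ) < p then f ((i + (col : ℕ) : ℕ) : ℝ)
        else - f' ((i + ((col : ℕ) - p) : ℕ) : ℝ)) * v col := by
  refine Finset.sum_congr rfl fun col _ => ?_
  split_ifs with hlt
  · rfl
  · rw [(hf _).hasDerivWithinAt.derivWithin (uniqueDiffOn_Icc (by exact_mod_cast hn) _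
      (node_mem_Icc hi (by omega)))]

/-- Splitting a sum over the `2 p` weights into the value part and the derivative part. -/
theorem sum_fin_two_mul (F : ℕ → ℝ) :
    ∑ col : Fin (2 * p), F col = ∑ r ∈ Finset.range p, F r + ∑ r ∈ Finset.range p, F (p + r) := by
  rw [Fin.sum_univ_eq_sum_range F, two_mul, Finset.sum_range_add]

/-- Polynomials of degree at most `p` are combinations of B-splines. -/
theorem exists_coeff_polynomial (hn : 1 ≤ n) (q : Polynomial ℝ) (hq : q.natDegree ≤ p) :
    ∃ c : ℤ → ℝ, ∀ t ∈ Set.Icc (0 : ℝ) n,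
      q.eval t = ∑ m ∈ Finset.Ico (-(p : ℤ)) n, c m * refBspline p n m t := by
  have h : ∀ k ∈ Finset.range (p + 1), ∃ c : ℤ → ℝ, ∀ t ∈ Set.Icc (0 : ℝ) n,
      t ^ k = ∑ m ∈ Finset.Ico (-(p : ℤ)) n, c m * refBspline p n m t := fun k hk =>
    exists_coeff_monomial hn (by rw [Finset.mem_range] at hk; omega)
  choose! c hc using h
  refine ⟨fun m => ∑ k ∈ Finset.range (p + 1), q.coeff k * c k m, fun t ht => ?_⟩
  rw [Polynomial.eval_eq_sum_range' (Nat.lt_succ_of_le hq)]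
  simp only [Finset.sum_mul]
  rw [Finset.sum_comm]
  refine Finset.sum_congr rfl fun k hk => ?_
  rw [hc k hk t ht, Finset.mul_sum]
  exact Finset.sum_congr rfl fun m _ => by ring

/-- The local systems are uniquely solvable. -/
theorem det_bsMatrix_ne_zero (hp : 1 ≤ p) (hpn : p ≤ n) (hi : i + p ≤ n + 1) :
    (bsMatrix p n i).det ≠ 0 := by
  intro hdet
  obtain ⟨v, hv0, hv⟩ := Matrix.exists_mulVec_eq_zero_iff.2 hdet
  refine hv0 ?_
  have hn : 1 ≤ n := hp.trans hpn
  have hsum : derivWeightSum p v = 0 := by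
    rw [← bsMatrix_mulVec_last (n := n) (i := i) (⟨2 * p - 1, by omega⟩ : Fin (2 * p))
      (by simp; omega), hv]
    rfl
  have hB : ∀ m ∈ Finset.Ico (-(p : ℤ)) n, hermiteFunctional p n i v (refBspline p n m) = 0 := by
    intro m hm
    rw [Finset.mem_Ico] at hm
    by_cases hout : m < (i : ℤ) - p ∨ (i : ℤ) + p - 1 ≤ m
    · exact hermiteFunctional_refBspline_eq_zero hp hi hpn hsum hm.1 hm.2 hout
    · have h := bsMatrix_mulVec_of_lt (n := n) (i := i) (v := v)
        (⟨(m - (i - p)).toNat, by omega⟩ : Fin (2 * p)) (by simp only; omega)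
      rw [hv] at h
      simp only [Int.toNat_of_nonneg (by omega : 0 ≤ m - ((i : ℤ) - p)), Pi.zero_apply,
        add_sub_cancel] at h
      exact h.symm
  have hspan : ∀ g : ℝ → ℝ, (∃ c : ℤ → ℝ, ∀ t ∈ Set.Icc (0 : ℝ) n,
      g t = ∑ m ∈ Finset.Ico (-(p : ℤ)) n, c m * refBspline p n m t) →
      hermiteFunctional p n i v g = 0 := by
    rintro g ⟨c, hc⟩
    rw [hermiteFunctional_sum _ c _ hn hi
      ((derivWeight_or_differentiableOn hp hn hsum).imp id fun h m _ => h m) hc]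
    exact Finset.sum_eq_zero fun m hm => by rw [hB m hm, mul_zero]
  rcases hp.lt_or_eq with hp2 | rfl
  · let w : ℕ → ℝ := fun r => if h : r < 2 * p then v ⟨r, h⟩ else 0
    have hw : ∀ col : Fin (2 * p), w col = v col := fun col => by simp [w]
    have key : ∀ r < p, w r = 0 ∧ w (p + r) = 0 := by
      refine functional_eq_zero hp2 w (fun r => w (p + r)) (fun k => ?_) ?_
      · -- The truncated power at `i + k` is zero on the nodes, a combination of B-splines or a
        -- polynomial on the nodes, according to the position of `k`.
        obtain ⟨f, f', hf, hspanf, hfv, hfd⟩ : ∃ f f' : ℝ → ℝ, (∀ t, HasDerivAt f (f' t) t) ∧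
            hermiteFunctional p n i v f = 0 ∧
            (∀ r < p, f ((i + r : ℕ) : ℝ) = (max ((r : ℝ) - k) 0) ^ p) ∧
            (∀ r < p, f' ((i + r : ℕ) : ℝ) = p * (max ((r : ℝ) - k) 0) ^ (p - 1)) := by
          rcases le_or_gt k 0 with hk | hk
          · have hmax : ∀ r : ℕ, max ((r : ℝ) - k) 0 = r - k := fun r => by
              have : (k : ℝ) ≤ 0 := by exact_mod_cast hk
              exact max_eq_left (by linarith [(Nat.cast_nonneg r : (0 : ℝ) ≤ r)])
            refine ⟨fun t => (t - (i + k)) ^ p, fun t => p * (t - (i + k)) ^ (p - 1), fun t => ?_,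
              hspan _ ?_, fun r _ => ?_, fun r _ => ?_⟩
            · simpa using ((hasDerivAt_id t).sub_const ((i : ℝ) + k)).fun_pow p
            · obtain ⟨c, hc⟩ := exists_coeff_polynomial (p := p) hn
                ((Polynomial.X - Polynomial.C ((i : ℝ) + k)) ^ p) (by
                  rw [Polynomial.natDegree_pow, Polynomial.natDegree_X_sub_C, mul_one])
              exact ⟨c, fun t ht => by rw [← hc t ht]; simp⟩
            · rw [hmax]; push_cast; ring
            · rw [hmax]; push_cast; ring
          · rcases le_or_gt ((p : ℤ) - 1) k with hkp | hkp
            · have hmax : ∀ r < p, max ((r : ℝ) - k) 0 = 0 := fun r hr => by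
                have : ((r : ℤ) : ℝ) ≤ k := by exact_mod_cast (by omega : (r : ℤ) ≤ k)
                push_cast at this
                exact max_eq_right (by linarith)
              refine ⟨fun _ => 0, fun _ => 0, fun t => hasDerivAt_const _ _, hspan _ ⟨0, by simp⟩,
                fun r hr => ?_, fun r hr => ?_⟩
              · rw [hmax r hr, zero_pow (by omega)]
              · rw [hmax r hr, zero_pow (by omega), mul_zero]
            · obtain ⟨k, rfl⟩ := Int.eq_ofNat_of_zero_le hk.le
              have hsub : ∀ r : ℕ, ((i + r : ℕ) : ℝ) - ((i + k : ℕ) : ℝ) = r - ((k : ℤ) : ℝ) :=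
                fun r => by push_cast; ring
              refine ⟨fun t => (max (t - (i + k : ℕ)) 0) ^ p,
                fun t => p * (max (t - (i + k : ℕ)) 0) ^ (p - 1),
                fun t => hasDerivAt_truncPow hp2 _ t,
                hspan _ (exists_coeff_truncPow hp (by omega) (by omega)),
                fun r _ => by simp only [hsub], fun r _ => by simp only [hsub]⟩
        have h := hermiteFunctional_of_hasDerivAt (v := v) hn hi hf
        rw [hspanf] at h
        have h' := sum_fin_two_mul (p := p) fun c => (if c < p then f ((i + c : ℕ) : ℝ)
          else - f' ((i + (c - p) : ℕ) : ℝ)) * w c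
        simp only [hw] at h'
        rw [← h] at h'
        have e1 : ∑ r ∈ Finset.range p, w r * (max ((r : ℝ) - k) 0) ^ p
            = ∑ r ∈ Finset.range p, (if r < p then f ((i + r : ℕ) : ℝ)
              else - f' ((i + (r - p) : ℕ) : ℝ)) * w r := by
          refine Finset.sum_congr rfl fun r hr => ?_
          rw [Finset.mem_range] at hr
          rw [if_pos hr, hfv r hr, mul_comm]
        have e2 : ∑ r ∈ Finset.range p, w (p + r) * (p * (max ((r : ℝ) - k) 0) ^ (p - 1))
            = - ∑ r ∈ Finset.range p, (if p + r < p then f ((i + (p + r) : ℕ) : ℝ)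
              else - f' ((i + (p + r - p) : ℕ) : ℝ)) * w (p + r) := by
          rw [← Finset.sum_neg_distrib]
          refine Finset.sum_congr rfl fun r hr => ?_
          rw [Finset.mem_range] at hr
          rw [if_neg (by omega), show p + r - p = r by omega, hfd r hr]
          ring
        rw [e1, e2]
        linarith
      · have h' := sum_fin_two_mul (p := p) fun c => (if c < p then (0 : ℝ) else 1) * w c
        simp only [hw] at h'
        rw [← derivWeightSum, hsum, Finset.sum_eq_zero (s := Finset.range p) (fun r hr => by
          rw [Finset.mem_range] at hr; simp [hr]), zero_add] at h'
        rw [h']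
        exact Finset.sum_congr rfl fun r _ => by simp
    ext col
    rw [← hw, Pi.zero_apply]
    rcases lt_or_ge (col : ℕ) p with h | h
    · exact (key _ h).1
    · have := (key (col - p) (by omega)).2
      rwa [show p + ((col : ℕ) - p) = col by omega] at this
  · have h1 := derivWeight_eq_zero_of_one hsum
    have h2 := hspan (fun _ => 1) (by
      simpa using exists_coeff_monomial (p := 1) hn (q := 0) (by omega))
    rw [hermiteFunctional, Fin.sum_univ_two] at h2
    have h3 : v 1 = 0 := h1 1 le_rfl
    rw [h3] at h2
    ext col
    fin_cases col
    · simpa using h2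
    · exact h3

end Functional

/-! ### The quasi-interpolant reproduces polynomials -/

section Reproduction

variable {p n : ℕ} {S : ℕ → Finset ℕ} {j : ℤ}

theorem windowStart_add_le (hpn : p ≤ n) (j : ℤ) : windowStart p n j + p ≤ n + 1 := by
  unfold windowStart
  omega

theorem mem_window (hp : 1 ≤ p) (hpn : p ≤ n) (hj : -(p : ℤ) ≤ j) (hjn : j < n) :
    (windowStart p n j : ℤ) - p ≤ j ∧ j + 1 < (windowStart p n j : ℤ) + p := by
  unfold windowStart
  omega

/-- The coefficient functionals are dual to the B-splines. -/
theorem hermiteFunctional_bsCoeff (hp : 1 ≤ p) (hpn : p ≤ n) (hj : -(p : ℤ) ≤ j) (hjn : j < n) :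
    derivWeightSum p (bsCoeff p n j) = 0 ∧ ∀ m ∈ Finset.Ico (-(p : ℤ)) n,
      hermiteFunctional p n (windowStart p n j) (bsCoeff p n j) (refBspline p n m)
        = if m = j then 1 else 0 := by
  have hi := windowStart_add_le hpn j
  have hw := mem_window hp hpn hj hjn
  set i := windowStart p n j with hidef
  have hunit : IsUnit (bsMatrix p n i).det := (det_bsMatrix_ne_zero hp hpn hi).isUnit
  have hsolve : (bsMatrix p n i).mulVec (bsCoeff p n j)
      = fun row : Fin (2 * p) => if ((row : ℕ) : ℤ) = j - ((i : ℤ) - p) then 1 else 0 := by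
    rw [bsCoeff, Matrix.mulVec_mulVec, ← hidef, Matrix.mul_nonsing_inv _ hunit, Matrix.one_mulVec]
  have hsum : derivWeightSum p (bsCoeff p n j) = 0 := by
    rw [← bsMatrix_mulVec_last (n := n) (i := i) (⟨2 * p - 1, by omega⟩ : Fin (2 * p))
      (by simp; omega), hsolve]
    simp only
    rw [if_neg (by omega)]
  refine ⟨hsum, fun m hm => ?_⟩
  rw [Finset.mem_Ico] at hm
  by_cases hout : m < (i : ℤ) - p ∨ (i : ℤ) + p - 1 ≤ m
  · rw [hermiteFunctional_refBspline_eq_zero hp hi hpn hsum hm.1 hm.2 hout, if_neg (by omega)]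
  · have h := bsMatrix_mulVec_of_lt (n := n) (i := i) (v := bsCoeff p n j)
      (⟨(m - (i - p)).toNat, by omega⟩ : Fin (2 * p)) (by simp only; omega)
    rw [hsolve] at h
    simp only [Int.toNat_of_nonneg (by omega : 0 ≤ m - ((i : ℤ) - p)), add_sub_cancel] at h
    rw [← h]
    exact if_congr (by omega) rfl rfl

/-- The finite differences are exact for polynomials of degree at most `p`. -/
theorem sum_fdWeight (hS : IsStencil p n S) {r : ℕ} (hr : r ≤ n) (q : Polynomial ℝ)
    (hq : q.natDegree ≤ p) :
    ∑ k ∈ Finset.range (n + 1), fdWeight S r k * q.eval (k : ℝ) = q.derivative.eval (r : ℝ) := by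
  obtain ⟨hsub, hcard⟩ := hS r hr
  have hinj : Set.InjOn (fun k : ℕ => (k : ℝ)) (S r : Set ℕ) := Nat.cast_injective.injOn
  have hinterp := Lagrange.eq_interpolate (f := q) hinj
    (lt_of_le_of_lt Polynomial.degree_le_natDegree (by exact_mod_cast (by omega)))
  rw [Lagrange.interpolate_apply] at hinterp
  conv_rhs => rw [hinterp]
  rw [Polynomial.derivative_sum, Polynomial.eval_finsetSum]
  symm
  refine Finset.sum_subset_zero_on_sdiff hsub (fun k hk => ?_) (fun k hk => ?_)
  · rw [fdWeight, if_neg (Finset.mem_sdiff.1 hk).2, zero_mul]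
  · simp only [fdWeight, if_pos hk, Polynomial.derivative_C_mul, Polynomial.eval_mul,
      Polynomial.eval_C]
    ring

theorem sum_qiMatrix (hp : 1 ≤ p) (hpn : p ≤ n) (hS : IsStencil p n S) (j : ℤ)
    (q : Polynomial ℝ) (hq : q.natDegree ≤ p) :
    ∑ k ∈ Finset.range (n + 1), qiMatrix p n S k j * q.eval (k : ℝ)
      = hermiteFunctional p n (windowStart p n j) (bsCoeff p n j) fun t => q.eval t := by
  have hi := windowStart_add_le hpn j
  rw [hermiteFunctional_of_hasDerivAt (by omega) hi (fun t => q.hasDerivAt t)]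
  simp only [qiMatrix, Finset.sum_mul]
  rw [Finset.sum_comm]
  refine Finset.sum_congr rfl fun col _ => ?_
  split_ifs with hlt
  · rw [Finset.sum_eq_single (windowStart p n j + (col : ℕ))]
    · rw [if_pos rfl, mul_comm]
    · intro k _ hk
      rw [if_neg hk, zero_mul]
    · intro h
      exact absurd (Finset.mem_range.2 (by omega)) h
  · rw [← sum_fdWeight hS (r := windowStart p n j + ((col : ℕ) - p)) (by omega) q hq, neg_mul,
      Finset.sum_mul, ← Finset.sum_neg_distrib]
    exact Finset.sum_congr rfl fun k _ => by ring

theorem refBspline_reproduction (hp : 1 ≤ p) (hpn : p ≤ n) (hS : IsStencil p n S)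
    (q : Polynomial ℝ) (hq : q.natDegree ≤ p) {t : ℝ} (ht : t ∈ Set.Icc (0 : ℝ) n) :
    ∑ j ∈ Finset.Ico (-(p : ℤ)) n,
      (∑ k ∈ Finset.range (n + 1), qiMatrix p n S k j * q.eval (k : ℝ)) * refBspline p n j t
      = q.eval t := by
  have hn : 1 ≤ n := hp.trans hpn
  obtain ⟨c, hc⟩ := exists_coeff_polynomial hn q hq
  rw [hc t ht]
  refine Finset.sum_congr rfl fun j hj => ?_
  have hj' := Finset.mem_Ico.1 hj
  obtain ⟨h1, h2⟩ := hermiteFunctional_bsCoeff hp hpn hj'.1 hj'.2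
  rw [sum_qiMatrix hp hpn hS j q hq, hermiteFunctional_sum _ c _ hn (windowStart_add_le hpn j)
    ((derivWeight_or_differentiableOn hp hn h1).imp id fun h m _ => h m) hc,
    Finset.sum_eq_single j]
  · rw [h2 j hj, if_pos rfl, mul_one]
  · intro m hm hmj
    rw [h2 m hm, if_neg hmj, mul_zero]
  · exact fun h => absurd hj h

variable {x y : ℝ}

theorem qiBasis_affine (hxy : x < y) (hn : 1 ≤ n) (j : ℤ) (t : ℝ) :
    qiBasis x y p n j t = refBspline p n j ((t - x) / ((y - x) / n)) := by
  have hnR : (0 : ℝ) < n := by exact_mod_cast hn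
  have hh : 0 < (y - x) / n := div_pos (by linarith) hnR
  have e : clampedKnots x ((y - x) / n) n = fun k => x + (y - x) / n * clampedKnots 0 1 n k := by
    ext k
    rw [clampedKnots_zero_one, clampedKnots]
  have et : t = x + (y - x) / n * ((t - x) / ((y - x) / n)) := by
    rw [mul_div_cancel₀ _ hh.ne']
    ring
  conv_lhs => rw [qiBasis, e, et]
  exact bspline_affine hh _ _ _ _

theorem div_step_mem_Icc (hxy : x < y) (hn : 1 ≤ n) {t : ℝ} (ht : t ∈ Set.Icc x y) :
    (t - x) / ((y - x) / n) ∈ Set.Icc (0 : ℝ) n := by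
  have hnR : (0 : ℝ) < n := by exact_mod_cast hn
  have hh : 0 < (y - x) / n := div_pos (by linarith) hnR
  refine ⟨div_nonneg (by linarith [ht.1]) hh.le, ?_⟩
  rw [div_le_iff₀ hh, mul_div_cancel₀ _ hnR.ne']
  linarith [ht.2]

theorem qiBasis_reproduction (hp : 1 ≤ p) (hpn : p ≤ n) (hS : IsStencil p n S) (hxy : x < y)
    (q : Polynomial ℝ) (hq : q.natDegree ≤ p) {t : ℝ} (ht : t ∈ Set.Icc x y) :
    ∑ j ∈ Finset.Ico (-(p : ℤ)) n,
      (∑ k ∈ Finset.range (n + 1), qiMatrix p n S k j * q.eval (node x y n k)) * qiBasis x y p n j t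
      = q.eval t := by
  have hn : 1 ≤ n := hp.trans hpn
  have hnR : (0 : ℝ) < n := by exact_mod_cast hn
  have hh : 0 < (y - x) / n := div_pos (by linarith) hnR
  let Q : Polynomial ℝ := q.comp (Polynomial.C ((y - x) / n) * Polynomial.X + Polynomial.C x)
  have hQ : Q.natDegree ≤ p := by
    refine Polynomial.natDegree_comp_le.trans ?_
    exact (Nat.mul_le_mul_left _ Polynomial.natDegree_linear_le).trans (by omega)
  have h := refBspline_reproduction hp hpn hS Q hQ (div_step_mem_Icc hxy hn ht)
  have e : ∀ u, Q.eval u = q.eval (x + (y - x) / n * u) := fun u => by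
    simp [Q, Polynomial.eval_comp, add_comm]
  simp only [e, mul_div_cancel₀ _ hh.ne', add_sub_cancel] at h
  rw [← h]
  refine Finset.sum_congr rfl fun j _ => ?_
  rw [qiBasis_affine hxy hn]
  rfl

theorem abs_qiBasis_le (hxy : x < y) (hn : 1 ≤ n) (j : ℤ) {t : ℝ} (ht : t ∈ Set.Icc x y) :
    |qiBasis x y p n j t| ≤ (2 * (n : ℝ) + 1) ^ p := by
  rw [qiBasis_affine hxy hn]
  have hu := div_step_mem_Icc hxy hn ht
  refine abs_bspline_le one_pos (fun i j hij => ?_) p fun k _ _ => ?_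
  · rw [clampedKnots_zero_one, clampedKnots_zero_one] at *
    have : max 0 (min i (n : ℤ)) < max 0 (min j (n : ℤ)) := by exact_mod_cast hij
    have : max 0 (min i (n : ℤ)) + 1 ≤ max 0 (min j (n : ℤ)) := this
    have : ((max 0 (min i (n : ℤ)) : ℤ) : ℝ) + 1 ≤ ((max 0 (min j (n : ℤ)) : ℤ) : ℝ) := by
      exact_mod_cast this
    linarith
  · rw [clampedKnots_zero_one, mul_one, abs_le]
    have h1 : ((0 : ℤ) : ℝ) ≤ ((max 0 (min k (n : ℤ)) : ℤ) : ℝ) :=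
      Int.cast_le.2 (by omega)
    have h2 : ((max 0 (min k (n : ℤ)) : ℤ) : ℝ) ≤ ((n : ℤ) : ℝ) :=
      Int.cast_le.2 (by omega)
    push_cast at h1 h2 ⊢
    constructor <;> linarith [hu.1, hu.2]

end Reproduction

/-! ### The error of the rule for a general weight -/

section ErrorBound

open MeasureTheory

variable {p n : ℕ} {S : ℕ → Finset ℕ} {x y : ℝ} {w : ℝ → ℝ}

/-- A bound for the norm of the quasi-interpolation operator with respect to the sup norm. -/
noncomputable def qiNorm (p n : ℕ) (S : ℕ → Finset ℕ) : ℝ :=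
  ∑ k ∈ Finset.range (n + 1), ∑ j ∈ Finset.Ico (-(p : ℤ)) (n : ℤ),
    |qiMatrix p n S k j| * (2 * (n : ℝ) + 1) ^ p

theorem qiNorm_nonneg (p n : ℕ) (S : ℕ → Finset ℕ) : 0 ≤ qiNorm p n S :=
  Finset.sum_nonneg fun _ _ => Finset.sum_nonneg fun _ _ => by positivity

theorem integrableOn_mul_qiBasis (hxy : x < y) (hn : 1 ≤ n) (hw : IntegrableOn w (Set.Icc x y))
    (j : ℤ) : IntegrableOn (fun t => w t * qiBasis x y p n j t) (Set.Icc x y) := by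
  refine Integrable.mul_bdd (c := (2 * (n : ℝ) + 1) ^ p) hw
    (measurable_bspline _ _ _).aestronglyMeasurable ?_
  refine (ae_restrict_iff' measurableSet_Icc).2 (Filter.Eventually.of_forall fun t ht => ?_)
  exact abs_qiBasis_le hxy hn j ht

theorem node_mem (hxy : x < y) (hn : 1 ≤ n) {k : ℕ} (hk : k ≤ n) :
    node x y n k ∈ Set.Icc x y := by
  have hnR : (0 : ℝ) < n := by exact_mod_cast hn
  have hh : 0 < (y - x) / n := div_pos (by linarith) hnR
  have hkR : (k : ℝ) ≤ n := by exact_mod_cast hk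
  unfold node
  refine ⟨by nlinarith [(Nat.cast_nonneg k : (0 : ℝ) ≤ k)], ?_⟩
  have : (y - x) / n * k ≤ (y - x) / n * n := by gcongr
  rw [div_mul_cancel₀ _ hnR.ne'] at this
  linarith

theorem abs_qiRule_le (hxy : x < y) (hn : 1 ≤ n) (hw : IntegrableOn w (Set.Icc x y))
    {f : ℝ → ℝ} {ε : ℝ} (hf : ∀ t ∈ Set.Icc x y, |f t| ≤ ε) :
    |qiRule x y p n S w f| ≤ ε * qiNorm p n S * ∫ t in Set.Icc x y, |w t| := by
  have hint : ∀ j, |∫ t in Set.Icc x y, w t * qiBasis x y p n j t|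
      ≤ (2 * (n : ℝ) + 1) ^ p * ∫ t in Set.Icc x y, |w t| := by
    intro j
    rw [← integral_const_mul, ← Real.norm_eq_abs]
    refine norm_integral_le_of_norm_le (hw.abs.const_mul _) ?_
    refine (ae_restrict_iff' measurableSet_Icc).2 (Filter.Eventually.of_forall fun t ht => ?_)
    rw [Real.norm_eq_abs, abs_mul, mul_comm]
    exact mul_le_mul_of_nonneg_right (abs_qiBasis_le hxy hn j ht) (abs_nonneg _)
  have hI : 0 ≤ ∫ t in Set.Icc x y, |w t| := integral_nonneg fun _ => abs_nonneg _
  unfold qiRule qiNorm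
  refine (Finset.abs_sum_le_sum_abs _ _).trans ?_
  rw [Finset.mul_sum, Finset.sum_mul]
  refine Finset.sum_le_sum fun k hk => ?_
  rw [Finset.mem_range] at hk
  have hfk := hf _ (node_mem hxy hn (k := k) (by omega))
  rw [abs_mul]
  calc _ ≤ (∑ j ∈ Finset.Ico (-(p : ℤ)) (n : ℤ), |qiMatrix p n S k j| *
        ((2 * (n : ℝ) + 1) ^ p * ∫ t in Set.Icc x y, |w t|)) * ε := by
        refine mul_le_mul ?_ hfk (abs_nonneg _) ?_
        · refine (Finset.abs_sum_le_sum_abs _ _).trans (Finset.sum_le_sum fun j _ => ?_)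
          rw [abs_mul]
          exact mul_le_mul_of_nonneg_left (hint j) (abs_nonneg _)
        · exact Finset.sum_nonneg fun j _ => by positivity
    _ = _ := by
        rw [Finset.mul_sum, Finset.sum_mul, Finset.sum_mul]
        exact Finset.sum_congr rfl fun j _ => by ring

theorem qiRule_polynomial (hp : 1 ≤ p) (hpn : p ≤ n) (hS : IsStencil p n S) (hxy : x < y)
    (hw : IntegrableOn w (Set.Icc x y)) (q : Polynomial ℝ) (hq : q.natDegree ≤ p) :
    qiRule x y p n S w (fun t => q.eval t) = ∫ t in Set.Icc x y, w t * q.eval t := by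
  have hn : 1 ≤ n := hp.trans hpn
  have e : ∀ t ∈ Set.Icc x y, w t * q.eval t = ∑ j ∈ Finset.Ico (-(p : ℤ)) n,
      (∑ k ∈ Finset.range (n + 1), qiMatrix p n S k j * q.eval (node x y n k)) *
        (w t * qiBasis x y p n j t) := by
    intro t ht
    rw [← qiBasis_reproduction hp hpn hS hxy q hq ht, Finset.mul_sum]
    exact Finset.sum_congr rfl fun j _ => by ring
  rw [setIntegral_congr_fun measurableSet_Icc e, integral_finsetSum]
  · simp only [integral_const_mul]
    simp only [qiRule, Finset.sum_mul]
    rw [Finset.sum_comm]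
    exact Finset.sum_congr rfl fun j _ => Finset.sum_congr rfl fun k _ => by ring
  · exact fun j _ => (integrableOn_mul_qiBasis hxy hn hw j).const_mul _

theorem qiRule_sub (f g : ℝ → ℝ) :
    qiRule x y p n S w (fun t => f t - g t) = qiRule x y p n S w f - qiRule x y p n S w g := by
  simp only [qiRule, mul_sub, Finset.sum_sub_distrib]

/-- Taylor's theorem on a compact interval, in terms of `derivSupNorm`. -/
theorem exists_polynomial_near (hxy : x < y) {f : ℝ → ℝ}
    (hf : ContDiffOn ℝ ((p + 1 : ℕ) : WithTop ℕ∞) f (Set.Icc x y)) :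
    0 ≤ derivSupNorm (p + 1) f (Set.Icc x y) ∧
    ∃ q : Polynomial ℝ, q.natDegree ≤ p ∧ ∀ t ∈ Set.Icc x y,
      |f t - q.eval t| ≤ derivSupNorm (p + 1) f (Set.Icc x y) * (y - x) ^ (p + 1) := by
  have hcont : ContinuousOn (fun t => |iteratedDerivWithin (p + 1) f (Set.Icc x y) t|)
      (Set.Icc x y) :=
    (hf.continuousOn_iteratedDerivWithin le_rfl (uniqueDiffOn_Icc hxy)).abs
  have hC : ∀ t ∈ Set.Icc x y, ‖iteratedDerivWithin (p + 1) f (Set.Icc x y) t‖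
      ≤ derivSupNorm (p + 1) f (Set.Icc x y) := fun t ht =>
    le_csSup (isCompact_Icc.bddAbove_image hcont) ⟨t, ht, rfl⟩
  have h0 : 0 ≤ derivSupNorm (p + 1) f (Set.Icc x y) :=
    (norm_nonneg _).trans (hC x ⟨le_rfl, hxy.le⟩)
  refine ⟨h0, ∑ k ∈ Finset.range (p + 1),
    Polynomial.C ((k.factorial : ℝ)⁻¹ * iteratedDerivWithin k f (Set.Icc x y) x) *
      (Polynomial.X - Polynomial.C x) ^ k, ?_, fun t ht => ?_⟩
  · refine Polynomial.natDegree_sum_le_of_forall_le _ _ fun k hk => ?_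
    refine (Polynomial.natDegree_C_mul_le _ _).trans ?_
    rw [Polynomial.natDegree_pow, Polynomial.natDegree_X_sub_C, mul_one]
    rw [Finset.mem_range] at hk
    omega
  · have h := taylor_mean_remainder_bound (n := p) hxy.le (by exact_mod_cast hf) ht hC
    rw [taylor_within_apply, Real.norm_eq_abs] at h
    have e : (∑ k ∈ Finset.range (p + 1),
        Polynomial.C ((k.factorial : ℝ)⁻¹ * iteratedDerivWithin k f (Set.Icc x y) x) *
          (Polynomial.X - Polynomial.C x) ^ k).eval t
        = ∑ k ∈ Finset.range (p + 1), (((k.factorial : ℝ))⁻¹ * (t - x) ^ k) •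
          iteratedDerivWithin k f (Set.Icc x y) x := by
      simp only [Polynomial.eval_finsetSum, Polynomial.eval_mul, Polynomial.eval_C,
        Polynomial.eval_pow, Polynomial.eval_sub, Polynomial.eval_X, smul_eq_mul]
      exact Finset.sum_congr rfl fun k _ => by ring
    rw [e]
    refine h.trans ((div_le_self ?_ ?_).trans ?_)
    · exact mul_nonneg h0 (pow_nonneg (by linarith [ht.1]) _)
    · exact_mod_cast Nat.one_le_iff_ne_zero.2 (Nat.factorial_ne_zero p)
    · have := ht.1
      have := ht.2
      gcongr

theorem abs_integral_sub_qiRule_le (hp : 1 ≤ p) (hpn : p ≤ n) (hS : IsStencil p n S) (hxy : x < y)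
    (hw : IntegrableOn w (Set.Icc x y)) {f : ℝ → ℝ}
    (hf : ContDiffOn ℝ ((p + 1 : ℕ) : WithTop ℕ∞) f (Set.Icc x y)) :
    |(∫ t in Set.Icc x y, w t * f t) - qiRule x y p n S w f|
      ≤ derivSupNorm (p + 1) f (Set.Icc x y) * (y - x) ^ (p + 1) * (1 + qiNorm p n S)
        * ∫ t in Set.Icc x y, |w t| := by
  have hn : 1 ≤ n := hp.trans hpn
  obtain ⟨-, q, hq, hclose⟩ := exists_polynomial_near hxy hf
  set ε := derivSupNorm (p + 1) f (Set.Icc x y) * (y - x) ^ (p + 1)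
  have hmul : ∀ g : ℝ → ℝ, ContinuousOn g (Set.Icc x y) →
      IntegrableOn (fun t => w t * g t) (Set.Icc x y) := fun g hg =>
    hw.mul_continuousOn hg isCompact_Icc
  have h1 : (∫ t in Set.Icc x y, w t * f t) - qiRule x y p n S w f
      = (∫ t in Set.Icc x y, w t * (f t - q.eval t))
        - qiRule x y p n S w (fun t => f t - q.eval t) := by
    rw [qiRule_sub, qiRule_polynomial hp hpn hS hxy hw q hq]
    simp only [mul_sub]
    rw [integral_sub (hmul f hf.continuousOn) (hmul _ q.continuous.continuousOn)]
    ring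
  have h2 : |∫ t in Set.Icc x y, w t * (f t - q.eval t)| ≤ ε * ∫ t in Set.Icc x y, |w t| := by
    rw [← integral_const_mul, ← Real.norm_eq_abs]
    refine norm_integral_le_of_norm_le (hw.abs.const_mul _) ?_
    refine (ae_restrict_iff' measurableSet_Icc).2 (Filter.Eventually.of_forall fun t ht => ?_)
    rw [Real.norm_eq_abs, abs_mul, mul_comm]
    exact mul_le_mul_of_nonneg_right (hclose t ht) (abs_nonneg _)
  have h3 := abs_qiRule_le (p := p) (S := S) hxy hn hw hclose
  rw [h1]
  refine (abs_sub _ _).trans ((add_le_add h2 h3).trans_eq ?_)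
  ring

end ErrorBound

/-! ### The supports of the hierarchical B-splines -/

section Support

variable {a b : ℝ} (H : Hierarchy a b) (c : CurveKind)

theorem Hierarchy.numCells_pos (ℓ : ℕ) : 0 < H.numCells ℓ :=
  Nat.mul_pos H.L_pos (pow_pos two_pos ℓ)

theorem Hierarchy.meshSize_pos (hab : a < b) (ℓ : ℕ) : 0 < H.meshSize ℓ :=
  div_pos (by linarith) (by exact_mod_cast H.numCells_pos ℓ)

theorem Hierarchy.numCells_mul_meshSize (ℓ : ℕ) : H.numCells ℓ * H.meshSize ℓ = b - a :=
  mul_div_cancel₀ _ (by exact_mod_cast (H.numCells_pos ℓ).ne')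

/-- Both kinds of knots are `a + h * κ m` with a non-decreasing integer sequence `κ` that increases
by at most one in each step. -/
theorem Hierarchy.exists_knots_eq (ℓ : ℕ) : ∃ κ : ℤ → ℤ,
    (∀ m, H.knots c ℓ m = a + H.meshSize ℓ * κ m) ∧ Monotone κ ∧
    (∀ m (k : ℕ), κ (m + k) ≤ κ m + k) ∧
    ∀ (d : ℕ) (m : ℤ), -(d : ℤ) ≤ m → m < H.numCells ℓ →
      κ m < κ (m + d + 1) ∧ -(d : ℤ) ≤ κ m ∧ κ (m + d + 1) ≤ H.numCells ℓ + d := by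
  have hN := H.numCells_pos ℓ
  cases c with
  | openArc =>
    refine ⟨fun m => max 0 (min m (H.numCells ℓ)), fun m => rfl, fun i j hij => ?_, fun m k => ?_,
      fun d m h1 h2 => ?_⟩ <;> dsimp only <;> omega
  | closedCurve =>
    refine ⟨fun m => m, fun m => rfl, fun i j hij => hij, fun m k => le_rfl,
      fun d m h1 h2 => ?_⟩
    dsimp only
    omega

variable {d ℓ : ℕ} {m : ℤ}

theorem Hierarchy.supp_bounds (hab : a < b) (hm : -(d : ℤ) ≤ m) (hmN : m < H.numCells ℓ) :
    H.left c ℓ m < H.right c d ℓ m ∧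
    H.right c d ℓ m - H.left c ℓ m ≤ (d + 1) * H.meshSize ℓ ∧
    a - d * (b - a) ≤ H.left c ℓ m ∧ H.right c d ℓ m ≤ b + d * (b - a) ∧
    ∀ t ∈ H.supp c d ℓ m, |H.B c d ℓ m t| ≤ (2 * ((d : ℝ) + 1) + 1) ^ d := by
  obtain ⟨κ, hκ, hmono, hstep, hrange⟩ := H.exists_knots_eq c ℓ
  obtain ⟨h1, h2, h3⟩ := hrange d m hm hmN
  have hh := H.meshSize_pos hab ℓ
  have hNh := H.numCells_mul_meshSize ℓ
  have hN : (1 : ℝ) ≤ H.numCells ℓ := by exact_mod_cast H.numCells_pos ℓ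
  have hhle : H.meshSize ℓ ≤ b - a := by nlinarith
  have hlen : κ (m + d + 1) ≤ κ m + d + 1 := by
    have := hstep m (d + 1)
    push_cast at this
    rw [add_assoc m, add_assoc (κ m)]
    exact this
  have h1R : (κ m : ℝ) < κ (m + d + 1) := by exact_mod_cast h1
  have h2R : -(d : ℝ) ≤ κ m := by exact_mod_cast h2
  have h3R : (κ (m + d + 1) : ℝ) ≤ H.numCells ℓ + d := by exact_mod_cast h3
  have hlenR : (κ (m + d + 1) : ℝ) ≤ κ m + d + 1 := by exact_mod_cast hlen
  have hd : (0 : ℝ) ≤ d := by positivity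
  have hl : H.left c ℓ m = a + H.meshSize ℓ * κ m := hκ m
  have hr : H.right c d ℓ m = a + H.meshSize ℓ * κ (m + d + 1) := hκ _
  have hlen' : H.right c d ℓ m - H.left c ℓ m ≤ (d + 1) * H.meshSize ℓ := by
    rw [hl, hr]
    nlinarith
  refine ⟨by rw [hl, hr]; nlinarith, hlen', ?_, ?_, fun t ht => ?_⟩
  · rw [hl]
    nlinarith
  · rw [hr]
    nlinarith
  · refine abs_bspline_le hh (fun i j hij => ?_) d fun j hj1 hj2 => ?_
    · rw [hκ, hκ] at hij ⊢
      have hlt : (κ i : ℝ) < κ j := by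
        by_contra hge
        nlinarith
      have : κ i + 1 ≤ κ j := by exact_mod_cast hlt
      have : (κ i : ℝ) + 1 ≤ κ j := by exact_mod_cast this
      nlinarith
    · have e1 : H.left c ℓ m ≤ H.knots c ℓ j := by
        rw [hl, hκ]
        have : (κ m : ℝ) ≤ κ j := by exact_mod_cast hmono hj1
        nlinarith
      have e2 : H.knots c ℓ j ≤ H.right c d ℓ m := by
        rw [hr, hκ]
        have : (κ j : ℝ) ≤ κ (m + d + 1) := by exact_mod_cast hmono hj2
        nlinarith
      obtain ⟨ht1, ht2⟩ : H.left c ℓ m ≤ t ∧ t ≤ H.right c d ℓ m := ht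
      rw [abs_le]
      constructor <;> linarith

end Support

/-! ### The logarithmic weight -/

section LogWeight

open MeasureTheory

theorem integrableOn_log_sub (s x y : ℝ) :
    IntegrableOn (fun t => Real.log (s - t)) (Set.Icc x y) := by
  rcases le_or_gt x y with hxy | hxy
  · have h : IntervalIntegrable Real.log volume (s - x) (s - y) :=
      intervalIntegral.intervalIntegrable_log'
    have h2 := h.comp_sub_left s
    simp only [sub_sub_cancel] at h2
    exact (intervalIntegrable_iff_integrableOn_Icc_of_le hxy).1 h2
  · simp [Set.Icc_eq_empty (not_le.2 hxy)]

theorem one_le_abs_log {h : ℝ} (hh : 0 < h) (he : h ≤ Real.exp (-1)) :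
    1 ≤ |Real.log h| ∧ |Real.log h| = -Real.log h := by
  have : Real.log h ≤ -1 := by
    rw [← Real.log_exp (-1)]
    exact Real.log_le_log hh he
  have h2 : |Real.log h| = -Real.log h := abs_of_nonpos (by linarith)
  exact ⟨by rw [h2]; linarith, h2⟩

/-- The singularity of the logarithm costs no more than a factor `|log h|` on an interval of length
`O(h)`: at distance at least `h` from the singularity `|log|` is at most `|log h|`, and the integral
over the remaining interval `[s - h, s + h]` is computed exactly. -/
theorem setIntegral_abs_log_le {h R Λ s x y : ℝ} (hh : 0 < h) (he : h ≤ Real.exp (-1))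
    (hR : 0 < R) (hhR : h ≤ R⁻¹) (hxy : x ≤ y) (hlen : y - x ≤ Λ * h)
    (hdist : ∀ t ∈ Set.Icc x y, |s - t| ≤ R) :
    ∫ t in Set.Icc x y, |Real.log (s - t)| ≤ (Λ + 4) * (h * |Real.log h|) := by
  obtain ⟨hlog1, hlogeq⟩ := one_le_abs_log hh he
  have hh1 : h ≤ 1 := he.trans (Real.exp_le_one_iff.2 (by norm_num))
  let J := Set.Icc (s - h) (s + h)
  let f : ℝ → ℝ := J.indicator fun t => -Real.log (s - t)
  have hneg : ∀ t ∈ J, |Real.log (s - t)| = -Real.log (s - t) := by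
    intro t ht
    refine abs_of_nonpos ?_
    rw [← Real.log_abs]
    refine Real.log_nonpos (abs_nonneg _) ?_
    rw [abs_le]
    constructor <;> linarith [ht.1, ht.2]
  have hf0 : ∀ t, 0 ≤ f t := by
    refine Set.indicator_nonneg fun t ht => ?_
    rw [← hneg t ht]
    exact abs_nonneg _
  have hfint : Integrable f :=
    (integrableOn_log_sub s _ _).neg.integrable_indicator measurableSet_Icc
  have hpt : ∀ t ∈ Set.Icc x y, |Real.log (s - t)| ≤ |Real.log h| + f t := by
    intro t ht
    by_cases hJ : t ∈ J
    · have : f t = |Real.log (s - t)| := by rw [hneg t hJ]; exact Set.indicator_of_mem hJ _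
      rw [this]
      linarith [abs_nonneg (Real.log h)]
    · have hfar : h ≤ |s - t| := by
        by_contra hlt
        rw [not_le, abs_lt] at hlt
        exact hJ ⟨by linarith, by linarith⟩
      have hl1 : Real.log h ≤ Real.log (s - t) := by
        rw [← Real.log_abs (s - t)]
        exact Real.log_le_log hh hfar
      have hl2 : Real.log (s - t) ≤ -Real.log h := by
        rw [← Real.log_abs (s - t), ← Real.log_inv]
        refine Real.log_le_log (hh.trans_le hfar) ((hdist t ht).trans ?_)
        exact (le_inv_comm₀ hh hR).1 hhR
      have : |Real.log (s - t)| ≤ |Real.log h| := by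
        rw [hlogeq, abs_le]
        exact ⟨by linarith, hl2⟩
      linarith [hf0 t]
  have hfval : ∫ t, f t = 2 * h + 2 * (h * |Real.log h|) := by
    rw [integral_indicator measurableSet_Icc, integral_Icc_eq_integral_Ioc,
      ← intervalIntegral.integral_of_le (by linarith),
      intervalIntegral.integral_comp_sub_left (fun u => -Real.log u),
      intervalIntegral.integral_neg, integral_log, hlogeq,
      show s - (s + h) = -h by ring, sub_sub_cancel, Real.log_neg_eq_log]
    ring
  have hconst : ∫ _ in Set.Icc x y, |Real.log h| = (y - x) * |Real.log h| := by
    rw [setIntegral_const, Real.volume_real_Icc_of_le hxy, smul_eq_mul]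
  have hcint : IntegrableOn (fun _ : ℝ => |Real.log h|) (Set.Icc x y) :=
    integrableOn_const (by simp)
  calc ∫ t in Set.Icc x y, |Real.log (s - t)|
      ≤ ∫ t in Set.Icc x y, (|Real.log h| + f t) :=
        setIntegral_mono_on (integrableOn_log_sub s x y).abs
          (IntegrableOn.add hcint hfint.integrableOn)
          measurableSet_Icc hpt
    _ = (y - x) * |Real.log h| + ∫ t in Set.Icc x y, f t := by
        rw [integral_add hcint hfint.integrableOn, hconst]
    _ ≤ Λ * h * |Real.log h| + (2 * h + 2 * (h * |Real.log h|)) := by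
        have := setIntegral_le_integral (s := Set.Icc x y) hfint
          (Filter.Eventually.of_forall hf0)
        rw [hfval] at this
        gcongr
    _ ≤ (Λ + 4) * (h * |Real.log h|) := by nlinarith

theorem measurable_log_delta (a b : ℝ) (c : CurveKind) (s : ℝ) :
    Measurable fun t => Real.log (delta a b c s t) := by
  refine Real.measurable_log.comp (?_ : Measurable fun t => delta a b c s t)
  cases c <;> simp only [delta]
  · exact (continuous_const.sub continuous_id).abs.measurable
  · fun_prop

/-- For a closed curve `δ` has three zeros, at `t = s` and `t = s ± (b - a)`. -/
theorem abs_log_delta_le {a b : ℝ} (hab : a < b) (c : CurveKind) (s t : ℝ) :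
    |Real.log (delta a b c s t)| ≤ |Real.log (s - t)| + |Real.log (s - (b - a) - t)|
      + |Real.log (s + (b - a) - t)| + 2 * |Real.log (b - a)| := by
  have n1 := abs_nonneg (Real.log (s - t))
  have n2 := abs_nonneg (Real.log (s - (b - a) - t))
  have n3 := abs_nonneg (Real.log (s + (b - a) - t))
  have n4 := abs_nonneg (Real.log (b - a))
  cases c with
  | openArc =>
    simp only [delta, Real.log_abs]
    linarith
  | closedCurve =>
    have e : delta a b .closedCurve s t
        = |s - t| * |(s - (b - a) - t) * (s + (b - a) - t)| / (b - a) ^ 2 := by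
      simp only [delta]
      congr 3
      ring
    have hγ : (b - a) ^ 2 ≠ 0 := pow_ne_zero _ (by linarith)
    by_cases h0 : s - t = 0 ∨ s - (b - a) - t = 0 ∨ s + (b - a) - t = 0
    · have : delta a b .closedCurve s t = 0 := by
        rw [e]
        rcases h0 with h | h | h <;> rw [h] <;> simp
      rw [this, Real.log_zero, abs_zero]
      linarith
    · push Not at h0
      obtain ⟨h1, h2, h3⟩ := h0
      rw [e, Real.log_div (mul_ne_zero (abs_ne_zero.2 h1) (abs_ne_zero.2 (mul_ne_zero h2 h3))) hγ,
        Real.log_mul (abs_ne_zero.2 h1) (abs_ne_zero.2 (mul_ne_zero h2 h3)), Real.log_abs,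
        Real.log_abs, Real.log_mul h2 h3, Real.log_pow]
      push_cast
      rw [abs_le]
      constructor <;>
        linarith [neg_abs_le (Real.log (s - t)), neg_abs_le (Real.log (s - (b - a) - t)),
          neg_abs_le (Real.log (s + (b - a) - t)), neg_abs_le (Real.log (b - a)),
          le_abs_self (Real.log (s - t)), le_abs_self (Real.log (s - (b - a) - t)),
          le_abs_self (Real.log (s + (b - a) - t)), le_abs_self (Real.log (b - a))]

theorem setIntegral_abs_log_delta_le {a b : ℝ} (hab : a < b) (c : CurveKind) {h R Λ s x y : ℝ}
    (hh : 0 < h) (he : h ≤ Real.exp (-1)) (hR : 0 < R) (hhR : h ≤ R⁻¹) (hxy : x ≤ y)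
    (hlen : y - x ≤ Λ * h) (hdist : ∀ t ∈ Set.Icc x y, |s - t| + (b - a) ≤ R) :
    IntegrableOn (fun t => Real.log (delta a b c s t)) (Set.Icc x y) ∧
    ∫ t in Set.Icc x y, |Real.log (delta a b c s t)|
      ≤ (3 * (Λ + 4) + 2 * Λ * |Real.log (b - a)|) * (h * |Real.log h|) := by
  have hconst : IntegrableOn (fun _ : ℝ => 2 * |Real.log (b - a)|) (Set.Icc x y) :=
    integrableOn_const (by simp)
  have i1 := (integrableOn_log_sub s x y).abs
  have i2 := (integrableOn_log_sub (s - (b - a)) x y).abs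
  have i3 := (integrableOn_log_sub (s + (b - a)) x y).abs
  have i12 : IntegrableOn (fun t => |Real.log (s - t)| + |Real.log (s - (b - a) - t)|)
    (Set.Icc x y) := i1.add i2
  have i123 : IntegrableOn (fun t => |Real.log (s - t)| + |Real.log (s - (b - a) - t)|
    + |Real.log (s + (b - a) - t)|) (Set.Icc x y) := i12.add i3
  have hsum : IntegrableOn (fun t => |Real.log (s - t)| + |Real.log (s - (b - a) - t)|
    + |Real.log (s + (b - a) - t)| + 2 * |Real.log (b - a)|) (Set.Icc x y) := i123.add hconst
  have hint : IntegrableOn (fun t => Real.log (delta a b c s t)) (Set.Icc x y) :=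
    Integrable.mono' hsum (measurable_log_delta a b c s).aestronglyMeasurable
      (Filter.Eventually.of_forall fun t => abs_log_delta_le hab c s t)
  refine ⟨hint, ?_⟩
  have e1 := setIntegral_abs_log_le (s := s) hh he hR hhR hxy hlen fun t ht => by
    linarith [hdist t ht]
  have e2 := setIntegral_abs_log_le (s := s - (b - a)) hh he hR hhR hxy hlen fun t ht => by
    have := abs_sub (s - t) (b - a)
    rw [abs_of_pos (by linarith : 0 < b - a)] at this
    rw [sub_right_comm]
    linarith [hdist t ht]
  have e3 := setIntegral_abs_log_le (s := s + (b - a)) hh he hR hhR hxy hlen fun t ht => by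
    have := abs_add_le (s - t) (b - a)
    rw [abs_of_pos (by linarith : 0 < b - a)] at this
    rw [add_sub_right_comm]
    linarith [hdist t ht]
  have e4 : ∫ _ in Set.Icc x y, 2 * |Real.log (b - a)|
      ≤ 2 * Λ * |Real.log (b - a)| * (h * |Real.log h|) := by
    rw [setIntegral_const, Real.volume_real_Icc_of_le hxy, smul_eq_mul]
    have h1 := (one_le_abs_log hh he).1
    have hΛ : 0 ≤ Λ * h := by linarith
    calc (y - x) * (2 * |Real.log (b - a)|) ≤ (Λ * h) * (2 * |Real.log (b - a)|) := by gcongr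
      _ ≤ (Λ * h * |Real.log h|) * (2 * |Real.log (b - a)|) := by
          exact mul_le_mul_of_nonneg_right (le_mul_of_one_le_right hΛ h1) (by positivity)
      _ = _ := by ring
  calc ∫ t in Set.Icc x y, |Real.log (delta a b c s t)|
      ≤ ∫ t in Set.Icc x y, (|Real.log (s - t)| + |Real.log (s - (b - a) - t)|
        + |Real.log (s + (b - a) - t)| + 2 * |Real.log (b - a)|) :=
        setIntegral_mono_on hint.abs hsum measurableSet_Icc fun t _ => abs_log_delta_le hab c s t
    _ = (∫ t in Set.Icc x y, |Real.log (s - t)|) + (∫ t in Set.Icc x y, |Real.log (s - (b - a) - t)|)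
        + (∫ t in Set.Icc x y, |Real.log (s + (b - a) - t)|)
        + ∫ _ in Set.Icc x y, 2 * |Real.log (b - a)| := by
        rw [integral_add i123 hconst, integral_add i12 i3, integral_add i1 i2]
    _ ≤ _ := by linarith

end LogWeight

/-! ### The error bounds -/

open MeasureTheory in
theorem integrableOn_B {a b : ℝ} (hab : a < b) (H : Hierarchy a b) (c : CurveKind) {d ℓ : ℕ} {m : ℤ}
    (hm : -(d : ℤ) ≤ m) (hmN : m < H.numCells ℓ) {u : ℝ → ℝ}
    (hu : IntegrableOn u (H.supp c d ℓ m)) :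
    IntegrableOn (fun t => u t * H.B c d ℓ m t) (H.supp c d ℓ m) ∧
    ∫ t in H.supp c d ℓ m, |u t * H.B c d ℓ m t|
      ≤ (2 * ((d : ℝ) + 1) + 1) ^ d * ∫ t in H.supp c d ℓ m, |u t| := by
  obtain ⟨-, -, -, -, hB⟩ := H.supp_bounds c hab hm hmN
  have hmeas : MeasurableSet (H.supp c d ℓ m) := measurableSet_Icc
  have hint : IntegrableOn (fun t => u t * H.B c d ℓ m t) (H.supp c d ℓ m) :=
    Integrable.mul_bdd (c := (2 * ((d : ℝ) + 1) + 1) ^ d) hu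
      (measurable_bspline _ _ _).aestronglyMeasurable
      ((ae_restrict_iff' hmeas).2 (Filter.Eventually.of_forall hB))
  refine ⟨hint, ?_⟩
  rw [← integral_const_mul]
  refine setIntegral_mono_on hint.abs (hu.abs.const_mul _) hmeas fun t ht => ?_
  rw [abs_mul, mul_comm]
  exact mul_le_mul_of_nonneg_right (hB t ht) (abs_nonneg _)

theorem contDiffOn_auxFun {a b : ℝ} (c : CurveKind) {N : WithTop ℕ∞} {g : ℝ → ℝ} {D : Set ℝ}
    (hg : ContDiffOn ℝ N g (Set.Icc a b))
    (hD : ¬ D ⊆ Set.Icc a b → ContDiffOn ℝ N (auxFun a b c g) D) :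
    ContDiffOn ℝ N (auxFun a b c g) D := by
  by_cases h : D ⊆ Set.Icc a b
  · refine (hg.mono h).congr fun t ht => ?_
    cases c with
    | openArc => rfl
    | closedCurve => exact if_pos (h ht)
  · exact hD h

end QIQuad

theorem proposition1 (p n d : ℕ) (hp : 1 ≤ p) (hn : p ≤ n) (S : ℕ → Finset ℕ)
    (hS : QIQuad.IsStencil p n S) (a b : ℝ) (hab : a < b) (c : QIQuad.CurveKind) :
    ∃ C₁ C₂ h₀ : ℝ, 0 < C₁ ∧ 0 < C₂ ∧ 0 < h₀ ∧
      ∀ g : ℝ → ℝ, ContDiffOn ℝ ((p + 1 : ℕ) : WithTop ℕ∞) g (Set.Icc a b) →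
      ∀ (H : QIQuad.Hierarchy a b) (ℓ : ℕ) (m : ℤ), H.IsActive c d ℓ m →
        H.meshSize ℓ ≤ h₀ →
        (¬ H.supp c d ℓ m ⊆ Set.Icc a b →
          ContDiffOn ℝ ((p + 1 : ℕ) : WithTop ℕ∞) (QIQuad.auxFun a b c g) (H.supp c d ℓ m)) →
        |QIQuad.errReg H c d ℓ m p n S (QIQuad.auxFun a b c g)|
            ≤ C₁ * H.meshSize ℓ ^ (p + 2)
              * QIQuad.derivSupNorm (p + 1) (QIQuad.auxFun a b c g) (H.supp c d ℓ m) ∧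
        ∀ s ∈ Set.Icc a b,
          |QIQuad.errSing H c d ℓ m p n S (QIQuad.auxFun a b c g) s|
            ≤ C₂ * H.meshSize ℓ ^ (p + 2) * |Real.log (H.meshSize ℓ)|
              * QIQuad.derivSupNorm (p + 1) (QIQuad.auxFun a b c g) (H.supp c d ℓ m) := by
  have hγ : 0 < b - a := by linarith
  have hκ := QIQuad.qiNorm_nonneg p n S
  let K : ℝ := ((d : ℝ) + 1) ^ (p + 1) * (1 + QIQuad.qiNorm p n S) * (2 * ((d : ℝ) + 1) + 1) ^ d
  have hK : 0 < K := by positivity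
  let Λ : ℝ := 3 * ((d : ℝ) + 1 + 4) + 2 * ((d : ℝ) + 1) * |Real.log (b - a)|
  have hΛ : 0 < Λ := by positivity
  let R : ℝ := ((d : ℝ) + 2) * (b - a)
  have hR : 0 < R := by positivity
  refine ⟨K * (d + 1), K * Λ, min (Real.exp (-1)) R⁻¹, by positivity, by positivity,
    lt_min (Real.exp_pos _) (inv_pos.2 hR), ?_⟩
  intro g hg H ℓ m hact hsmall hper
  obtain ⟨-, hm, hmN, -, -⟩ := hact
  obtain ⟨hlr, hlen, hleft, hright, -⟩ := H.supp_bounds c hab hm hmN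
  have hG := QIQuad.contDiffOn_auxFun c hg hper
  have hh := H.meshSize_pos hab ℓ
  set h := H.meshSize ℓ
  set G := QIQuad.auxFun a b c g
  set M := QIQuad.derivSupNorm (p + 1) G (H.supp c d ℓ m)
  have hM : 0 ≤ M := (QIQuad.exists_polynomial_near hlr hG).1
  -- The error bound for any weight `u * B` with `∫ |u| ≤ I`.
  have main : ∀ (u : ℝ → ℝ) (I : ℝ), MeasureTheory.IntegrableOn u (H.supp c d ℓ m) →
      ∫ t in H.supp c d ℓ m, |u t| ≤ I →
      |(∫ t in H.supp c d ℓ m, u t * H.B c d ℓ m t * G t)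
        - QIQuad.qiRule (H.left c ℓ m) (H.right c d ℓ m) p n S (fun t => u t * H.B c d ℓ m t) G|
      ≤ K * h ^ (p + 1) * M * I := by
    intro u I hu hI
    obtain ⟨hint, hle⟩ := QIQuad.integrableOn_B hab H c hm hmN hu
    refine (QIQuad.abs_integral_sub_qiRule_le hp hn hS hlr hint hG).trans ?_
    have hI0 : 0 ≤ ∫ t in H.supp c d ℓ m, |u t| :=
      MeasureTheory.integral_nonneg fun _ => abs_nonneg _
    have h0 : 0 ≤ H.right c d ℓ m - H.left c ℓ m := by linarith
    calc M * (H.right c d ℓ m - H.left c ℓ m) ^ (p + 1) * (1 + QIQuad.qiNorm p n S)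
          * ∫ t in H.supp c d ℓ m, |u t * H.B c d ℓ m t|
        ≤ M * (((d : ℝ) + 1) * h) ^ (p + 1) * (1 + QIQuad.qiNorm p n S)
          * ((2 * ((d : ℝ) + 1) + 1) ^ d * I) := by
          have hle' := hle.trans (mul_le_mul_of_nonneg_left hI (by positivity))
          gcongr
      _ = _ := by
          rw [mul_pow]
          simp only [K]
          ring
  constructor
  · have h1 := main (fun _ => 1) ((d + 1) * h)
      (MeasureTheory.integrableOn_const (by simp [QIQuad.Hierarchy.supp]))
      (by
        simp only [abs_one]
        rw [MeasureTheory.setIntegral_const, QIQuad.Hierarchy.supp,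
          Real.volume_real_Icc_of_le hlr.le, smul_eq_mul, mul_one]
        exact hlen)
    simp only [one_mul] at h1
    refine h1.trans_eq ?_
    ring
  · intro s hs
    obtain ⟨hint, hle⟩ := QIQuad.setIntegral_abs_log_delta_le (R := R) (s := s) hab c hh
      (hsmall.trans (min_le_left _ _)) hR (hsmall.trans (min_le_right _ _)) hlr.le hlen (by
        intro t ht
        have h1 := ht.1
        have h2 := ht.2
        have h3 := hs.1
        have h4 := hs.2
        have : |s - t| ≤ ((d : ℝ) + 1) * (b - a) := by
          rw [abs_le]
          constructor <;> linarith
        simp only [R]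
        linarith)
    refine (main _ _ hint hle).trans_eq ?_
    simp only [Λ]
    ring
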